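/- Let $u=(u_j)_{j\ge1}$ be real weights with $u_1\ge u_2\ge\cdots>0$. For $s\in\mathbb N=\{1,2,\dots\}$ let $$\mathcal S_{s,u}=\Bigl\{f\in C^\infty([0,1]^s;\mathbb R)\ :\ \|f\|_{\mathcal S_{s,u}}:=\sup_{\alpha\in\mathbb N_0^s}\frac{\|f^{(\alpha)}\|_{L^1([0,1]^s)}}{\prod_{j=1}^s u_j^{\alpha_j}}<\infty\Bigr\},\qquad f^{(\alpha)}=\frac{\partial^{|\alpha|}f}{\partial x_1^{\alpha_1}\cdots\partial x_s^{\alpha_s}}.$$ For $n\in\mathbb N$, an algorithm using $n$ function values is a map $A(f)=\phi(f(t_1),\dots,f(t_n))$ with $t_1,\dots,t_n\in[0,1)^s$ and an arbitrary function $\phi:\mathbb R^n\to\mathbb R$. Its worst-case error is $e^{\mathrm{wor}}(A)=\sup_{\|f\|_{\mathcal S_{s,u}}\le1}\bigl|\int_{[0,1)^s}f(x)\,dx-A(f)\bigr|$, and the minimal worst-case error $e(n,s)$ is the infimum of $e^{\mathrm{wor}}(A)$ over all algorithms $A$ using $n$ function values. For integers $b\ge2$ and $0\le d\le l$, and matrices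 $G_1,\dots,G_s\in(\mathbb Z/b)^{l\times d}$, the digital net over $\mathbb Z/b$ with precision $l$ is the family of $b^d$ points $x_k=(x_{k,1},\dots,x_{k,s})$, $0\le k<b^d$, with $x_{k,j}=\sum_{i=1}^l y_{i,k,j}b^{-i}$, where $(y_{1,k,j},\dots,y_{l,k,j})^\top=G_j(\kappa_1,\dots,\kappa_d)^\top$ modulo $b$ with $y_{i,k,j}\in\{0,\dots,b-1\}$, and $k=\sum_{i=1}^d\kappa_ib^{i-1}$ is the $b$-adic expansion of $k$. Its QMC rule is $P(f)=b^{-d}\sum_{k}f(x_k)$. (1) For every $s\in\mathbb N$ there are constants $c_{5,s},c_{6,s}>0$, depending on $s$ and $u$, such that $$e(n,s)\le c_{5,s}\exp\bigl(-c_{6,s}(\log n)^2\bigr)\qquad\text{for all }n\in\mathbb N.$$ Moreover, for every base $b\ge2$ and every $s\in\mathbb N$ there are constants $c_{5,s},c_{6,s}>0$, depending on $s$, $u$ and $b$, such that for every $n\in\mathbb N$ some digital net over $\mathbb Z/b$ with $b^{\lfloor\log_b n\rfloor}\le n$ points has a QMC rule with worst-case error at most $c_{5,s}\exp(-c_{6,s}(\log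 n)^2)$. (2) Let $1<p<2$ and suppose that $\liminf_{j\to\infty}\log(u_j^{-1})/j^{(p-1)/(2-p)}>0$ (the value $+\infty$ is allowed). Then there are constants $C,c>0$, independent of $s$ and $n$, such that $$e(n,s)\le C\exp\bigl(-c(\log n)^p\bigr)\qquad\text{for all }s,n\in\mathbb N.$$ Moreover, for every base $b\ge2$ there are constants $C,c>0$, depending on $b$ but independent of $s$ and $n$, such that for all $s,n\in\mathbb N$ some digital net over $\mathbb Z/b$ with $b^{\lfloor\log_b n\rfloor}\le n$ points has a QMC rule with worst-case error at most $C\exp(-c(\log n)^p)$. -/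

import Mathlib

open scoped ENNReal

noncomputable section

namespace SmoothIntegration

/-- The closed unit cube `[0,1]^s`. -/
def closedCube (s : ℕ) : Set (Fin s → ℝ) := Set.univ.pi fun _ => Set.Icc 0 1

/-- The half-open unit cube `[0,1)^s`, which contains the integration nodes. -/
def cube (s : ℕ) : Set (Fin s → ℝ) := Set.univ.pi fun _ => Set.Ico 0 1

/-- The partial derivative `∂f/∂x_j` on the closed unit cube (one-sided at the boundary). -/
def partialDeriv {s : ℕ} (j : Fin s) (f : (Fin s → ℝ) → ℝ) : (Fin s → ℝ) → ℝ :=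
  fun x => fderivWithin ℝ f (closedCube s) x (Pi.single j 1)

/-- The mixed partial derivative
`f^(α) = (∂/∂x_1)^(α_1) ⋯ (∂/∂x_s)^(α_s) f` on the closed unit cube. -/
def mixedDeriv {s : ℕ} (α : Fin s → ℕ) (f : (Fin s → ℝ) → ℝ) : (Fin s → ℝ) → ℝ :=
  (List.finRange s).foldr (fun j g => (partialDeriv j)^[α j] g) f

/-- The norm `sup_α ‖f^(α)‖_{L¹} / ∏_j u_j^(α_j)`, with values in `[0,∞]`. Coordinates and weights
are numbered from `0`, so that `u j` is the weight `u_{j+1}` of the `(j+1)`-st variable. -/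
def sNorm (u : ℕ → ℝ) {s : ℕ} (f : (Fin s → ℝ) → ℝ) : ℝ≥0∞ :=
  ⨆ α : Fin s → ℕ,
    (∫⁻ x in closedCube s, ‖mixedDeriv α f x‖ₑ) / ENNReal.ofReal (∏ j : Fin s, u j ^ α j)

/-- The space `S_{s,u}` of smooth functions on `[0,1]^s` with finite norm. Its elements are
represented by total functions; only their values on `[0,1]^s` are ever used. -/
def sSpace (u : ℕ → ℝ) (s : ℕ) : Set ((Fin s → ℝ) → ℝ) :=
  {f | ContDiffOn ℝ ((⊤ : ℕ∞) : WithTop ℕ∞) f (closedCube s) ∧ sNorm u f < ∞}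

/-- The integral of `f` over the unit cube. -/
def integral {s : ℕ} (f : (Fin s → ℝ) → ℝ) : ℝ := ∫ x in cube s, f x

/-- `A` is an algorithm that uses `n` function values:
`A f = φ (f (t_1), …, f (t_n))` with nodes in `[0,1)^s` and an arbitrary function `φ`. -/
def IsAlgorithm {s : ℕ} (n : ℕ) (A : ((Fin s → ℝ) → ℝ) → ℝ) : Prop :=
  ∃ t : Fin n → Fin s → ℝ, (∀ i, t i ∈ cube s) ∧
    ∃ φ : (Fin n → ℝ) → ℝ, ∀ f, A f = φ fun i => f (t i)

/-- The worst-case error of `A` on the unit ball of `S_{s,u}`, with values in `[0,∞]`. -/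
def worstCaseError (u : ℕ → ℝ) {s : ℕ} (A : ((Fin s → ℝ) → ℝ) → ℝ) : ℝ≥0∞ :=
  ⨆ f ∈ {f | f ∈ sSpace u s ∧ sNorm u f ≤ 1}, ENNReal.ofReal |integral f - A f|

/-- The `n`-th minimal worst-case error `e(n, s)` of integration over `S_{s,u}`. -/
def minError (u : ℕ → ℝ) (n s : ℕ) : ℝ≥0∞ :=
  ⨅ A ∈ {A : ((Fin s → ℝ) → ℝ) → ℝ | IsAlgorithm n A}, worstCaseError u A

/-- The quasi-Monte Carlo rule with nodes `t`: the mean of the function values. -/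
def qmcRule {s N : ℕ} (t : Fin N → Fin s → ℝ) : ((Fin s → ℝ) → ℝ) → ℝ :=
  fun f => (∑ i, f (t i)) / N

/-- The vector of the first `d` base-`b` digits of `k`, least significant digit first. -/
def digitVec (b d k : ℕ) : Fin d → ZMod b := fun i => ((k / b ^ (i : ℕ) % b : ℕ) : ZMod b)

/-- The digital net over `ℤ/b` with precision `l` and generating matrices `G_1, …, G_s`, as a
family of `b ^ d` points: the base-`b` digits of the `j`-th coordinate of the `k`-th point are the
entries of the product of `G_j` with the digit vector of `k`. -/
def digitalNet {b s l d : ℕ} (G : Fin s → Matrix (Fin l) (Fin d) (ZMod b)) :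
    Fin (b ^ d) → Fin s → ℝ :=
  fun k j => ∑ i : Fin l, (((G j).mulVec (digitVec b d k) i).val : ℝ) / (b : ℝ) ^ ((i : ℕ) + 1)

end SmoothIntegration

end

noncomputable section

namespace SmoothIntegration

open MeasureTheory

/-! Treat every base-`b` digit of every coordinate as a separate variable. The net is then the image
of a linear map `M` into the digit space, and its error is controlled by an ANOVA decomposition over
sets `A` of digit positions.

Sobolev embedding (`abs_mixedDeriv_le`) turns the L¹ bounds into sup bounds with `K = ∏ (1 + u_j)`.
Changing a digit in position `i`, counted from `0`, moves a coordinate by at most `b^(-i)`. Hence a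
mixed difference over `A` is at most `K ∏_{(j,i) ∈ A} θ_{j,i}`, where `θ_{j,i} = u_j b^(-i)`
(`abs_sum_powerset_mixedDeriv_le`). This uses derivatives of every order, since `A` may contain many
digits of one coordinate.

The component of a nonempty `A` is integrated exactly as soon as `M` maps onto the digits in `A`.
Let `F` be the family of all `A` with `∏_A θ > exp(-T)`. By a union bound over linear relations,
some `M` serves all of `F` once `∑_{A ∈ F} b^|A| < 2^d`. Rankin's trick bounds this sum by `exp(λT +
b ∑ θ^λ)`, and summing over digits gives `∑ θ^λ ≤ (2/λ) ∑ u_j^λ`.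

If `∑ u_j^λ ≤ B λ^(1 - 1/(p-1))`, then `λ ~ d^(-(p-1))` and `T ~ d^p` satisfy the condition. The
discarded components contribute `O(exp(-T/2))`, and a large precision `l` makes the discretization
error as small. With `d = ⌊log_b n⌋` this is the asserted rate. For fixed `s` the hypothesis holds
with `p = 2`; the decay of the weights in the second part gives it for the other `p`, uniformly in
`s`. -/

/-! ### Linear maps over `ℤ/b` and random generating matrices. -/

theorem sum_stdAddChar_dotProduct {ι : Type*} [Fintype ι] [DecidableEq ι] {b : ℕ} [NeZero b]
    {w : ι → ZMod b} (hw : w ≠ 0) : ∑ κ : ι → ZMod b, ZMod.stdAddChar (κ ⬝ᵥ w) = 0 := by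
  obtain ⟨i, hi⟩ := Function.ne_iff.mp hw
  let ψ : AddChar (ι → ZMod b) ℂ :=
    { toFun := fun κ => ZMod.stdAddChar (κ ⬝ᵥ w)
      map_zero_eq_one' := by simp
      map_add_eq_mul' := fun x y => by rw [add_dotProduct, AddChar.map_add_eq_mul] }
  have hψ : ψ ≠ 1 := by
    intro h
    refine ZMod.isPrimitive_stdAddChar b hi ?_
    ext c
    have := DFunLike.congr_fun h (Pi.single i c)
    simpa [ψ, AddChar.mulShift_apply, mul_comm] using this
  exact AddChar.sum_eq_zero_of_ne_one hψ

/-- A matrix over `ℤ/b` with independent rows defines a surjective map. -/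
theorem mulVec_surjective_of_vecMul_injective {ι κ : Type*} [Fintype ι] [Fintype κ]
    [DecidableEq ι] [DecidableEq κ] {b : ℕ} [NeZero b] (M : Matrix ι κ (ZMod b))
    (hM : ∀ v, Matrix.vecMul v M = 0 → v = 0) (y : ι → ZMod b) : ∃ x, M.mulVec x = y := by
  by_contra! hy
  -- Characters replace a dimension count, as `ℤ/b` need not be a field. If `y` is missed, every
  -- inner sum vanishes; in the other order of summation only `v = 0` survives, and its contribution
  -- is positive.
  have h0 : ∑ x : κ → ZMod b, ∑ v : ι → ZMod b, ZMod.stdAddChar (v ⬝ᵥ (M.mulVec x - y)) = 0 :=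
    Finset.sum_eq_zero fun x _ => sum_stdAddChar_dotProduct (sub_ne_zero.mpr (hy x))
  rw [Finset.sum_comm, Finset.sum_eq_single 0] at h0
  · simp [NeZero.ne b] at h0
  · intro v _ hv
    have hv' : Matrix.vecMul v M ≠ 0 := fun h => hv (hM v h)
    have := sum_stdAddChar_dotProduct hv'
    have hx : ∀ x, ZMod.stdAddChar (v ⬝ᵥ (M.mulVec x - y)) =
        ZMod.stdAddChar (x ⬝ᵥ Matrix.vecMul v M) * ZMod.stdAddChar (-(v ⬝ᵥ y)) := fun x => by
      rw [← AddChar.map_add_eq_mul, dotProduct_sub, Matrix.dotProduct_mulVec, dotProduct_comm x,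
        sub_eq_add_neg]
    simp_rw [hx, ← Finset.sum_mul, this, zero_mul]
  · simp

/-- Few matrices satisfy a given nontrivial linear relation between their rows. -/
theorem card_relation_mul_two_pow_le {ι : Type*} [Fintype ι] [DecidableEq ι] {b : ℕ} [NeZero b]
    (hb : 2 ≤ b) (d : ℕ) {v : ι → ZMod b} (hv : v ≠ 0) :
    (Finset.univ.filter fun M : Matrix ι (Fin d) (ZMod b) => Matrix.vecMul v M = 0).card * 2 ^ d ≤
      Fintype.card (Matrix ι (Fin d) (ZMod b)) := by
  obtain ⟨i, hi⟩ := Function.ne_iff.mp hv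
  have : Fact (1 < b) := ⟨hb⟩
  set S := Finset.univ.filter fun M : Matrix ι (Fin d) (ZMod b) => Matrix.vecMul v M = 0
  -- Translating a solution by the `2 ^ d` matrices with 0-1 entries in row `i` gives pairwise
  -- distinct matrices, because the relation recovers `v i * e`. The base is 2 and not `b`, since `v
  -- i` may be a zero divisor.
  let c : (Fin d → Bool) → Matrix ι (Fin d) (ZMod b) := fun e =>
    Matrix.of (Pi.single i fun k => if e k then 1 else 0)
  have hc : ∀ e k, Matrix.vecMul v (c e) k = if e k then v i else 0 := by
    intro e k
    simp only [Matrix.vecMul, dotProduct, c, Matrix.of_apply]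
    rw [Finset.sum_eq_single i]
    · simp
    · intro j _ hj
      simp [hj]
    · simp
  have hcard : (S ×ˢ (Finset.univ : Finset (Fin d → Bool))).card = S.card * 2 ^ d := by
    simp [Finset.card_product]
  rw [← hcard, ← Finset.card_univ]
  refine Finset.card_le_card_of_injOn (fun q => q.1 + c q.2) (fun _ _ => Finset.mem_coe.2 (Finset.mem_univ _)) ?_
  rintro ⟨M, e⟩ hM ⟨M', e'⟩ hM' h
  have hM0 : Matrix.vecMul v M = 0 := 
    (Finset.mem_filter.mp (Finset.mem_product.mp (Finset.mem_coe.mp hM)).1).2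
  have hM0' : Matrix.vecMul v M' = 0 := 
    (Finset.mem_filter.mp (Finset.mem_product.mp (Finset.mem_coe.mp hM')).1).2
  have h1 : Matrix.vecMul v (c e) = Matrix.vecMul v (c e') := by
    have := congrArg (Matrix.vecMul v) h
    simpa [Matrix.vecMul_add, hM0, hM0'] using this
  have he : e = e' := by
    funext k
    have hk := congrFun h1 k
    rw [hc, hc] at hk
    cases h2 : e k <;> cases h3 : e' k <;> rw [h2, h3] at hk
    · exact absurd (by simpa using hk.symm) hi
    · exact absurd (by simpa using hk) hi
  subst he
  simpa using h

/-- Existence of a matrix whose rows are independent along every member of a small family of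
index sets. -/
theorem exists_matrix_surjective {ι : Type*} [Fintype ι] [DecidableEq ι] {b : ℕ} [NeZero b]
    (hb : 2 ≤ b) (d : ℕ) (F : Finset (Finset ι)) (hF : ∑ A ∈ F, b ^ A.card < 2 ^ d) :
    ∃ M : Matrix ι (Fin d) (ZMod b), ∀ A ∈ F, ∀ y : ι → ZMod b,
      ∃ x, ∀ i ∈ A, M.mulVec x i = y i := by
  classical
  let ext : (A : Finset ι) → (A → ZMod b) → ι → ZMod b := fun A v i =>
    if h : i ∈ A then v ⟨i, h⟩ else 0
  -- Union bound: each nontrivial relation supported in `A` excludes at most a fraction `2 ^ (-d)`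
  -- of all matrices, and `A` carries `b ^ A.card` coefficient vectors.
  let bad : (A : Finset ι) → (A → ZMod b) → Finset (Matrix ι (Fin d) (ZMod b)) := fun A v =>
    Finset.univ.filter fun M => ext A v ≠ 0 ∧ Matrix.vecMul (ext A v) M = 0
  have hbad : ∀ A v, (bad A v).card * 2 ^ d ≤ Fintype.card (Matrix ι (Fin d) (ZMod b)) := by
    intro A v
    by_cases h : ext A v = 0
    · simp [bad, h]
    · simpa [bad, h] using card_relation_mul_two_pow_le hb d h
  have hlt : (F.biUnion fun A => Finset.univ.biUnion (bad A)).card <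
      Fintype.card (Matrix ι (Fin d) (ZMod b)) := by
    have hpos : 0 < Fintype.card (Matrix ι (Fin d) (ZMod b)) := Fintype.card_pos
    refine lt_of_mul_lt_mul_right ?_ (Nat.zero_le (2 ^ d))
    calc (F.biUnion fun A => Finset.univ.biUnion (bad A)).card * 2 ^ d
        ≤ (∑ A ∈ F, ∑ v : A → ZMod b, (bad A v).card) * 2 ^ d := by
          gcongr
          exact Finset.card_biUnion_le.trans (Finset.sum_le_sum fun A _ => Finset.card_biUnion_le)
      _ = ∑ A ∈ F, ∑ v : A → ZMod b, (bad A v).card * 2 ^ d := by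
          simp only [Finset.sum_mul]
      _ ≤ ∑ A ∈ F, ∑ v : A → ZMod b, Fintype.card (Matrix ι (Fin d) (ZMod b)) :=
          Finset.sum_le_sum fun A _ => Finset.sum_le_sum fun v _ => hbad A v
      _ = Fintype.card (Matrix ι (Fin d) (ZMod b)) * ∑ A ∈ F, b ^ A.card := by
          simp [Finset.mul_sum, mul_comm, ZMod.card]
      _ < Fintype.card (Matrix ι (Fin d) (ZMod b)) * 2 ^ d :=
          Nat.mul_lt_mul_of_pos_left hF hpos
  obtain ⟨M, hM⟩ : ∃ M, M ∉ F.biUnion fun A => Finset.univ.biUnion (bad A) := by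
    by_contra! h
    rw [Finset.eq_univ_iff_forall.mpr h, Finset.card_univ] at hlt
    exact lt_irrefl _ hlt
  refine ⟨M, fun A hA y => ?_⟩
  obtain ⟨x, hx⟩ := mulVec_surjective_of_vecMul_injective (M.submatrix (Subtype.val : A → ι) id)
    (fun v hv => by
      by_contra hv0
      refine hM (Finset.mem_biUnion.2 ⟨A, hA, Finset.mem_biUnion.2 ⟨v, Finset.mem_univ _, ?_⟩⟩)
      simp only [bad, Finset.mem_filter, Finset.mem_univ, true_and]
      refine ⟨fun h => hv0 ?_, ?_⟩
      · ext i
        simpa [ext] using congrFun h i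
      · rw [← hv]
        ext k
        simp only [Matrix.vecMul, dotProduct, Matrix.submatrix_apply, id]
        rw [← Finset.sum_subset (Finset.subset_univ A) (fun i _ hi => by simp [ext, hi]),
          ← Finset.sum_coe_sort]
        exact Finset.sum_congr rfl fun i _ => by simp [ext])
    (fun i => y i)
  exact ⟨x, fun i hi => congrFun hx ⟨i, hi⟩⟩

/-! ### Möbius inversion and the ANOVA decomposition. -/

theorem sum_powerset_insert_neg_one {ι : Type*} [DecidableEq ι] {A : Finset ι} {i : ι}
    (hiA : i ∉ A) (F : Finset ι → ℝ) :
    ∑ B ∈ (insert i A).powerset, (-1 : ℝ) ^ ((insert i A).card - B.card) * F B =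
      ∑ B ∈ A.powerset, (-1) ^ (A.card - B.card) * F (insert i B) -
        ∑ B ∈ A.powerset, (-1) ^ (A.card - B.card) * F B := by
  rw [Finset.sum_powerset_insert hiA, Finset.card_insert_of_notMem hiA, add_comm, sub_eq_add_neg,
    ← Finset.sum_neg_distrib]
  congr 1
  · refine Finset.sum_congr rfl fun B hB => ?_
    rw [Finset.card_insert_of_notMem fun h => hiA (Finset.mem_powerset.mp hB h),
      Nat.add_sub_add_right]
  · refine Finset.sum_congr rfl fun B hB => ?_
    rw [Nat.sub_add_comm (Finset.card_le_card (Finset.mem_powerset.mp hB)), pow_succ]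
    ring

/-- Möbius inversion on the Boolean lattice; it makes the ANOVA components add up to the function.
-/
theorem sum_powerset_sum_powerset_neg_one {ι : Type*} [DecidableEq ι] (S : Finset ι)
    (F : Finset ι → ℝ) :
    ∑ A ∈ S.powerset, ∑ B ∈ A.powerset, (-1) ^ (A.card - B.card) * F B = F S := by
  induction S using Finset.induction generalizing F with
  | empty => simp
  | insert i S hi ih =>
    rw [Finset.sum_powerset_insert hi, ih F]
    have h : ∀ A ∈ S.powerset,
        ∑ B ∈ (insert i A).powerset, (-1 : ℝ) ^ ((insert i A).card - B.card) * F B =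
          ∑ B ∈ A.powerset, (-1) ^ (A.card - B.card) * F (insert i B) -
            ∑ B ∈ A.powerset, (-1) ^ (A.card - B.card) * F B := fun A hA =>
      sum_powerset_insert_neg_one (fun h => hi (Finset.mem_powerset.mp hA h)) F
    rw [Finset.sum_congr rfl h, Finset.sum_sub_distrib, ih F, ih fun B => F (insert i B)]
    ring

theorem sum_powerset_neg_one_of_nonempty {ι : Type*} [DecidableEq ι] {A : Finset ι} (hA : A.Nonempty) :
    ∑ B ∈ A.powerset, (-1 : ℝ) ^ (A.card - B.card) = 0 := by
  have h := sum_powerset_sum_powerset_neg_one A fun _ => (1 : ℝ)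
  have h2 : ∑ B ∈ A.powerset, (-1 : ℝ) ^ (A.card - B.card) =
      (-1) ^ A.card * ∑ B ∈ A.powerset, (-1 : ℝ) ^ B.card := by
    rw [Finset.mul_sum]
    refine Finset.sum_congr rfl fun B hB => ?_
    have hc := Finset.card_le_card (Finset.mem_powerset.mp hB)
    obtain ⟨k, hk⟩ := Nat.exists_eq_add_of_le hc
    rw [hk, Nat.add_sub_cancel_left, pow_add, mul_right_comm, ← pow_add, ← two_mul, pow_mul]
    simp
  have h3 := Finset.sum_powerset_neg_one_pow_card_of_nonempty hA
  rw [h2, show ∑ B ∈ A.powerset, (-1 : ℝ) ^ B.card = ((∑ B ∈ A.powerset, (-1 : ℤ) ^ B.card : ℤ) : ℝ)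
    by push_cast; rfl, h3]
  simp

/-- The mixed difference of `g` over the coordinates in `A`, between `z` and `y`. -/
def mixedDiff {ι κ : Type*} [DecidableEq ι] (g : (ι → κ) → ℝ) (A : Finset ι) (y z : ι → κ) : ℝ :=
  ∑ B ∈ A.powerset, (-1) ^ (A.card - B.card) * g (B.piecewise y z)

/-- The sum over `z` of the mixed differences: up to normalization, the ANOVA component of `g`
that belongs to the set of coordinates `A`. -/
def anovaSum {ι κ : Type*} [DecidableEq ι] [Fintype ι] [Fintype κ] (g : (ι → κ) → ℝ)
    (A : Finset ι) (y : ι → κ) : ℝ := ∑ z, mixedDiff g A y z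

section Anova

variable {ι κ : Type*} [DecidableEq ι] [Fintype ι] [Fintype κ] (g : (ι → κ) → ℝ)

theorem sum_anovaSum (y : ι → κ) :
    ∑ A : Finset ι, anovaSum g A y = Fintype.card (ι → κ) * g y := by
  simp only [anovaSum, mixedDiff]
  rw [Finset.sum_comm]
  have h : ∀ z : ι → κ, ∑ A : Finset ι, ∑ B ∈ A.powerset,
      (-1) ^ (A.card - B.card) * g (B.piecewise y z) = g y := fun z => by
    have := sum_powerset_sum_powerset_neg_one Finset.univ fun B => g (B.piecewise y z)
    simpa using this
  rw [Finset.sum_congr rfl fun z _ => h z, Finset.sum_const, Finset.card_univ, nsmul_eq_mul]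

theorem anovaSum_empty (y : ι → κ) : anovaSum g ∅ y = ∑ z, g z := by
  simp [anovaSum, mixedDiff]

theorem anovaSum_congr {A : Finset ι} {y y' : ι → κ} (h : ∀ i ∈ A, y i = y' i) :
    anovaSum g A y = anovaSum g A y' := by
  refine Finset.sum_congr rfl fun z _ => Finset.sum_congr rfl fun B hB => ?_
  congr 2
  ext i
  by_cases hi : i ∈ B
  · simp [hi, h i (Finset.mem_powerset.mp hB hi)]
  · simp [hi]

/-- Exchanging `y` and `z` off `B` is an involution on pairs, so the mixed point is equidistributed.
-/
theorem sum_sum_piecewise (B : Finset ι) :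
    ∑ y : ι → κ, ∑ z, g (B.piecewise y z) = Fintype.card (ι → κ) * ∑ y, g y := by
  let e : (ι → κ) × (ι → κ) ≃ (ι → κ) × (ι → κ) :=
    { toFun := fun q => (B.piecewise q.1 q.2, B.piecewise q.2 q.1)
      invFun := fun q => (B.piecewise q.1 q.2, B.piecewise q.2 q.1)
      left_inv := fun q => by
        ext i <;> by_cases hi : i ∈ B <;> simp [hi]
      right_inv := fun q => by
        ext i <;> by_cases hi : i ∈ B <;> simp [hi] }
  rw [← Fintype.sum_prod_type']
  have := e.sum_comp fun q => g q.1
  simp only [e, Equiv.coe_fn_mk] at this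
  rw [this, Fintype.sum_prod_type]
  simp [Finset.mul_sum]

/-- After summation every `B ⊆ A` contributes the same total, and the signs cancel. -/
theorem sum_anovaSum_of_nonempty {A : Finset ι} (hA : A.Nonempty) : ∑ y, anovaSum g A y = 0 := by
  simp only [anovaSum, mixedDiff]
  have h : ∑ y : ι → κ, ∑ z, ∑ B ∈ A.powerset, (-1) ^ (A.card - B.card) * g (B.piecewise y z) =
      ∑ B ∈ A.powerset, (-1) ^ (A.card - B.card) * ∑ y : ι → κ, ∑ z, g (B.piecewise y z) := by
    rw [Finset.sum_congr rfl fun y _ => Finset.sum_comm, Finset.sum_comm]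
    simp only [Finset.mul_sum]
  rw [h]
  simp only [sum_sum_piecewise, ← Finset.sum_mul, sum_powerset_neg_one_of_nonempty hA, zero_mul]

end Anova

/-- A linear map that is onto the coordinates in `A` integrates functions of these coordinates
exactly. -/
theorem sum_comp_mulVec_of_surjective {ι κ : Type*} [Fintype ι] [Fintype κ] [DecidableEq ι]
    [DecidableEq κ] {b : ℕ} [NeZero b] (M : Matrix ι κ (ZMod b)) {A : Finset ι}
    (hM : ∀ y : ι → ZMod b, ∃ x, ∀ i ∈ A, M.mulVec x i = y i) {H : (ι → ZMod b) → ℝ}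
    (hH : ∀ y y', (∀ i ∈ A, y i = y' i) → H y = H y') (h0 : ∑ y, H y = 0) :
    ∑ x, H (M.mulVec x) = 0 := by
  -- On the coordinates in `A`, which are all that `H` sees, a shift by `y` is a shift of `x`.
  -- Averaging over `y` then gives the full sum of `H`.
  have h1 : ∀ y, ∑ x, H (M.mulVec x + y) = ∑ x, H (M.mulVec x) := by
    intro y
    obtain ⟨x₀, hx₀⟩ := hM y
    rw [← Equiv.sum_comp (Equiv.addRight x₀) fun x => H (M.mulVec x)]
    refine Finset.sum_congr rfl fun x _ => hH _ _ fun i hi => ?_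
    simp [Matrix.mulVec_add, hx₀ i hi]
  have h2 : ∑ y : ι → ZMod b, ∑ x, H (M.mulVec x + y) = 0 := by
    rw [Finset.sum_comm]
    refine Finset.sum_eq_zero fun x _ => ?_
    rw [← h0]
    exact Equiv.sum_comp (Equiv.addLeft (M.mulVec x)) H
  rw [Finset.sum_congr rfl fun y _ => h1 y, Finset.sum_const, nsmul_eq_mul] at h2
  exact (mul_eq_zero.mp h2).resolve_left (by simp [NeZero.ne b])

/-- The error of the mean over the image of a matrix, compared to the full mean, in terms of
bounds on mixed differences. -/
theorem abs_mean_comp_mulVec_sub_mean_le {ι : Type*} [Fintype ι] [DecidableEq ι] {b d : ℕ}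
    [NeZero b] (M : Matrix ι (Fin d) (ZMod b)) (F : Finset (Finset ι))
    (hM : ∀ A ∈ F, ∀ y : ι → ZMod b, ∃ x, ∀ i ∈ A, M.mulVec x i = y i)
    (hF : ∅ ∈ F) (g : (ι → ZMod b) → ℝ) (θ : Finset ι → ℝ)
    (hg : ∀ A y z, |mixedDiff g A y z| ≤ θ A) :
    |(∑ x, g (M.mulVec x)) / (b : ℝ) ^ d - (∑ y, g y) / (Fintype.card (ι → ZMod b) : ℝ)| ≤
      ∑ A ∈ Fᶜ, θ A := by
  set N : ℝ := (Fintype.card (ι → ZMod b) : ℝ) with hNdef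
  have hN : 0 < N := by rw [hNdef]; exact_mod_cast Fintype.card_pos
  have hb : (0 : ℝ) < (b : ℝ) ^ d := by
    have : 0 < b := Nat.pos_of_ne_zero (NeZero.ne b)
    positivity
  -- The empty set yields the full mean, the other members of `F` yield zero, and only `Fᶜ` remains
  -- as error.
  have key : ∑ x, N * g (M.mulVec x) =
      (b : ℝ) ^ d * ∑ y, g y + ∑ A ∈ Fᶜ, ∑ x, anovaSum g A (M.mulVec x) := by
    calc ∑ x, N * g (M.mulVec x) = ∑ x, ∑ A : Finset ι, anovaSum g A (M.mulVec x) := by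
          simp only [sum_anovaSum, N]
      _ = ∑ A : Finset ι, ∑ x, anovaSum g A (M.mulVec x) := Finset.sum_comm
      _ = ∑ A ∈ F, ∑ x, anovaSum g A (M.mulVec x) +
            ∑ A ∈ Fᶜ, ∑ x, anovaSum g A (M.mulVec x) := (Finset.sum_add_sum_compl F _).symm
      _ = _ := by
          congr 1
          rw [Finset.sum_eq_single_of_mem ∅ hF]
          · simp [anovaSum_empty]
          · intro A hA hne
            exact sum_comp_mulVec_of_surjective M (hM A hA) (fun y y' h => anovaSum_congr g h)
              (sum_anovaSum_of_nonempty g (Finset.nonempty_iff_ne_empty.mpr hne))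
  have hbound : |∑ A ∈ Fᶜ, ∑ x, anovaSum g A (M.mulVec x)| ≤ (b : ℝ) ^ d * N * ∑ A ∈ Fᶜ, θ A := by
    rw [Finset.mul_sum]
    refine (Finset.abs_sum_le_sum_abs _ _).trans (Finset.sum_le_sum fun A _ => ?_)
    refine (Finset.abs_sum_le_sum_abs _ _).trans ?_
    refine (Finset.sum_le_card_nsmul _ _ (N * θ A) fun x _ => ?_).trans_eq ?_
    · refine (Finset.abs_sum_le_sum_abs _ _).trans ?_
      refine (Finset.sum_le_card_nsmul _ _ (θ A) fun z _ => hg A _ z).trans_eq ?_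
      simp [N]
    · simp [mul_assoc]
  rw [← Finset.mul_sum] at key
  have heq : (∑ x, g (M.mulVec x)) / (b : ℝ) ^ d - (∑ y, g y) / N =
      (∑ A ∈ Fᶜ, ∑ x, anovaSum g A (M.mulVec x)) / ((b : ℝ) ^ d * N) := by
    field_simp
    linarith
  rw [heq, abs_div, abs_of_pos (mul_pos hb hN), div_le_iff₀ (mul_pos hb hN)]
  linarith

/-! ### Mixed derivatives and Sobolev embedding on the closed cube. -/

section Cube

variable {s : ℕ}

theorem convex_closedCube : Convex ℝ (closedCube s) := convex_pi fun _ _ => convex_Icc 0 1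

theorem closedCube_subset_closure_interior :
    closedCube s ⊆ closure (interior (closedCube s)) := by
  intro x hx
  rw [closedCube, interior_pi_set Set.finite_univ, closure_pi_set]
  simpa [interior_Icc, closure_Ioo zero_ne_one, closedCube] using hx

theorem uniqueDiffOn_closedCube : UniqueDiffOn ℝ (closedCube s) :=
  UniqueDiffOn.univ_pi fun _ => uniqueDiffOn_Icc zero_lt_one

/-- Smoothness on the closed unit cube. -/
abbrev SmoothOnCube (f : (Fin s → ℝ) → ℝ) : Prop :=
  ContDiffOn ℝ ((⊤ : ℕ∞) : WithTop ℕ∞) f (closedCube s)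

theorem SmoothOnCube.fderivWithin {f : (Fin s → ℝ) → ℝ} (hf : SmoothOnCube f) :
    ContDiffOn ℝ ((⊤ : ℕ∞) : WithTop ℕ∞) (fderivWithin ℝ f (closedCube s)) (closedCube s) :=
  ContDiffOn.fderivWithin hf uniqueDiffOn_closedCube (by simp)

theorem SmoothOnCube.partialDeriv {f : (Fin s → ℝ) → ℝ} (hf : SmoothOnCube f) (j : Fin s) :
    SmoothOnCube (partialDeriv j f) :=
  ContDiffOn.clm_apply hf.fderivWithin contDiffOn_const

theorem SmoothOnCube.iterate_partialDeriv {f : (Fin s → ℝ) → ℝ} (hf : SmoothOnCube f) (j : Fin s)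
    (n : ℕ) : SmoothOnCube ((SmoothIntegration.partialDeriv j)^[n] f) := by
  induction n with
  | zero => exact hf
  | succ n ih =>
    rw [Function.iterate_succ_apply']
    exact ih.partialDeriv j

theorem SmoothOnCube.foldr_partialDeriv {f : (Fin s → ℝ) → ℝ} (hf : SmoothOnCube f) (α : Fin s → ℕ)
    (l : List (Fin s)) :
    SmoothOnCube (l.foldr (fun j g => (SmoothIntegration.partialDeriv j)^[α j] g) f) := by
  induction l with
  | nil => exact hf
  | cons i l ih => exact ih.iterate_partialDeriv i (α i)

theorem SmoothOnCube.mixedDeriv {f : (Fin s → ℝ) → ℝ} (hf : SmoothOnCube f) (α : Fin s → ℕ) :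
    SmoothOnCube (mixedDeriv α f) := hf.foldr_partialDeriv α _

theorem partialDeriv_congr {f g : (Fin s → ℝ) → ℝ} (h : Set.EqOn f g (closedCube s)) (j : Fin s) :
    Set.EqOn (partialDeriv j f) (partialDeriv j g) (closedCube s) := fun x hx => by
  simp only [partialDeriv]
  rw [fderivWithin_congr h (h hx)]

theorem iterate_partialDeriv_congr {f g : (Fin s → ℝ) → ℝ} (h : Set.EqOn f g (closedCube s))
    (j : Fin s) (n : ℕ) :
    Set.EqOn ((partialDeriv j)^[n] f) ((partialDeriv j)^[n] g) (closedCube s) := by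
  induction n with
  | zero => exact h
  | succ n ih =>
    simp only [Function.iterate_succ_apply']
    exact partialDeriv_congr ih j

/-- Symmetry of second partial derivatives on the closed cube. -/
theorem partialDeriv_comm {f : (Fin s → ℝ) → ℝ} (hf : SmoothOnCube f) (i j : Fin s) :
    Set.EqOn (partialDeriv i (partialDeriv j f)) (partialDeriv j (partialDeriv i f))
      (closedCube s) := by
  intro x hx
  have h2 : ∀ k l : Fin s, partialDeriv k (partialDeriv l f) x =
      fderivWithin ℝ (fderivWithin ℝ f (closedCube s)) (closedCube s) x (Pi.single k 1)
        (Pi.single l 1) := by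
    intro k l
    have hd : DifferentiableWithinAt ℝ (fderivWithin ℝ f (closedCube s)) (closedCube s) x :=
      (hf.fderivWithin.differentiableOn (by simp)) x hx
    have := (hd.hasFDerivWithinAt.clm_apply
      (hasFDerivWithinAt_const (Pi.single l (1 : ℝ)) x (closedCube s))).fderivWithin
      (uniqueDiffOn_closedCube x hx)
    change fderivWithin ℝ (fun y => fderivWithin ℝ f (closedCube s) y (Pi.single l 1))
      (closedCube s) x (Pi.single k 1) = _
    rw [this]
    simp
  rw [h2, h2]
  exact (ContDiffOn.contDiffWithinAt hf hx).isSymmSndFDerivWithinAt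
    (by rw [minSmoothness_of_isRCLikeNormedField]; exact WithTop.coe_le_coe.2 (le_top : (2 : ℕ∞) ≤ ⊤))
    uniqueDiffOn_closedCube (closedCube_subset_closure_interior hx) hx _ _

theorem iterate_partialDeriv_comm {f : (Fin s → ℝ) → ℝ} (hf : SmoothOnCube f) (i j : Fin s)
    (n : ℕ) : Set.EqOn ((partialDeriv i)^[n] (partialDeriv j f))
      (partialDeriv j ((partialDeriv i)^[n] f)) (closedCube s) := by
  induction n with
  | zero => exact fun _ _ => rfl
  | succ n ih =>
    simp only [Function.iterate_succ_apply']
    exact (partialDeriv_congr ih i).trans (partialDeriv_comm (hf.iterate_partialDeriv i n) i j)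

/-- The mixed derivative has a fixed order of coordinates; the extra `∂_j` arises at the place of
`j` and is commuted to the outside. The case `j ∉ l` is needed in the induction once `j` has been
met. -/
theorem foldr_partialDeriv_add_single {f : (Fin s → ℝ) → ℝ} (hf : SmoothOnCube f) (α : Fin s → ℕ)
    (j : Fin s) (l : List (Fin s)) (hl : l.Nodup) :
    (j ∉ l → l.foldr (fun i g => (partialDeriv i)^[(α + Pi.single j 1 : Fin s → ℕ) i] g) f =
      l.foldr (fun i g => (partialDeriv i)^[α i] g) f) ∧
    (j ∈ l → Set.EqOn (l.foldr (fun i g => (partialDeriv i)^[(α + Pi.single j 1 : Fin s → ℕ) i] g) f)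
      (partialDeriv j (l.foldr (fun i g => (partialDeriv i)^[α i] g) f)) (closedCube s)) := by
  induction l with
  | nil => simp
  | cons i l ih =>
    obtain ⟨hil, hl'⟩ := List.nodup_cons.mp hl
    obtain ⟨ih1, ih2⟩ := ih hl'
    constructor
    · intro hj
      rw [List.mem_cons, not_or] at hj
      simp only [List.foldr_cons]
      rw [ih1 hj.2]
      simp [Ne.symm hj.1]
    · intro hj
      simp only [List.foldr_cons]
      by_cases hij : j = i
      · subst hij
        rw [ih1 hil, Pi.add_apply, Pi.single_eq_same, Function.iterate_succ_apply']
        exact fun _ _ => rfl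
      · have hjl : j ∈ l := (List.mem_cons.mp hj).resolve_left hij
        have h0 : (α + Pi.single j 1 : Fin s → ℕ) i = α i := by simp [Ne.symm hij]
        rw [h0]
        exact (iterate_partialDeriv_congr (ih2 hjl) i (α i)).trans
          (iterate_partialDeriv_comm (hf.foldr_partialDeriv α l) i j (α i))

theorem mixedDeriv_add_single {f : (Fin s → ℝ) → ℝ} (hf : SmoothOnCube f) (α : Fin s → ℕ)
    (j : Fin s) : Set.EqOn (mixedDeriv (α + Pi.single j 1) f) (partialDeriv j (mixedDeriv α f))
      (closedCube s) :=
  (foldr_partialDeriv_add_single hf α j _ (List.nodup_finRange s)).2 (List.mem_finRange j)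

theorem mixedDeriv_zero (f : (Fin s → ℝ) → ℝ) : mixedDeriv 0 f = f := by
  simp only [mixedDeriv, Pi.zero_apply, Function.iterate_zero, id]
  induction List.finRange s with
  | nil => rfl
  | cons i l ih => exact ih

/-- The derivative of a smooth function along a path in the cube parallel to a coordinate axis. -/
theorem SmoothOnCube.hasDerivWithinAt_comp {f : (Fin s → ℝ) → ℝ} (hf : SmoothOnCube f) {j : Fin s}
    {γ : ℝ → Fin s → ℝ} {I : Set ℝ} {t : ℝ} (hγ : HasDerivWithinAt γ (Pi.single j 1) I t)
    (hI : Set.MapsTo γ I (closedCube s)) (ht : t ∈ I) :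
    HasDerivWithinAt (fun t => f (γ t)) (SmoothIntegration.partialDeriv j f (γ t)) I t :=
  (((hf.differentiableOn (by simp)) (γ t) (hI ht)).hasFDerivWithinAt).comp_hasDerivWithinAt t hγ hI

theorem update_mem_closedCube {x : Fin s → ℝ} (hx : x ∈ closedCube s) (j : Fin s) {t : ℝ}
    (ht : t ∈ Set.Icc (0 : ℝ) 1) : Function.update x j t ∈ closedCube s := by
  intro i _
  by_cases h : i = j
  · subst h; simpa using ht
  · simpa [h] using hx i trivial

/-- Average `|h x| ≤ |h t| + ∫ |h'|` over `t` in the unit interval. -/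
theorem enorm_le_lintegral_add_lintegral_derivWithin {h : ℝ → ℝ}
    (hh : ContDiffOn ℝ 1 h (Set.Icc 0 1)) {x : ℝ} (hx : x ∈ Set.Icc (0 : ℝ) 1) :
    ‖h x‖ₑ ≤ (∫⁻ t in Set.Icc (0 : ℝ) 1, ‖h t‖ₑ) +
      ∫⁻ t in Set.Icc (0 : ℝ) 1, ‖derivWithin h (Set.Icc 0 1) t‖ₑ := by
  set D := ∫⁻ t in Set.Icc (0 : ℝ) 1, ‖derivWithin h (Set.Icc 0 1) t‖ₑ
  have hD : ∀ a b, a ∈ Set.Icc (0 : ℝ) 1 → b ∈ Set.Icc (0 : ℝ) 1 → a ≤ b →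
      ‖h b - h a‖ₑ ≤ D := by
    intro a b ha hb hab
    have hsub : Set.Icc a b ⊆ Set.Icc 0 1 := Set.Icc_subset_Icc ha.1 hb.2
    refine (enorm_sub_le_lintegral_deriv_of_contDiffOn_Icc (hh.mono hsub) hab).trans ?_
    rw [← restrict_Ioo_eq_restrict_Icc]
    calc ∫⁻ t in Set.Ioo a b, ‖deriv h t‖ₑ
        = ∫⁻ t in Set.Ioo a b, ‖derivWithin h (Set.Icc 0 1) t‖ₑ := by
          refine setLIntegral_congr_fun measurableSet_Ioo fun t ht => ?_
          rw [derivWithin_of_mem_nhds (Icc_mem_nhds (ha.1.trans_lt ht.1) (ht.2.trans_le hb.2))]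
      _ ≤ D := lintegral_mono_set (Set.Ioo_subset_Icc_self.trans hsub)
  have hpt : ∀ t ∈ Set.Icc (0 : ℝ) 1, ‖h x‖ₑ ≤ ‖h t‖ₑ + D := by
    intro t ht
    have h1 : ‖h x - h t‖ₑ ≤ D := by
      rcases le_total t x with h' | h'
      · exact hD t x ht hx h'
      · rw [← enorm_neg, neg_sub]
        exact hD x t hx ht h'
    calc ‖h x‖ₑ = ‖h t + (h x - h t)‖ₑ := by rw [add_sub_cancel]
      _ ≤ ‖h t‖ₑ + ‖h x - h t‖ₑ := enorm_add_le _ _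
      _ ≤ ‖h t‖ₑ + D := by gcongr
  calc ‖h x‖ₑ = ∫⁻ _ in Set.Icc (0 : ℝ) 1, ‖h x‖ₑ := by simp
    _ ≤ ∫⁻ t in Set.Icc (0 : ℝ) 1, (‖h t‖ₑ + D) := setLIntegral_mono' measurableSet_Icc hpt
    _ = (∫⁻ t in Set.Icc (0 : ℝ) 1, ‖h t‖ₑ) + D := by
      rw [lintegral_add_right _ measurable_const]; simp

/-- The projection of `ℝ^s` onto the closed unit cube. -/
def toCube (x : Fin s → ℝ) : Fin s → ℝ := fun j => max 0 (min 1 (x j))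

theorem toCube_mem (x : Fin s → ℝ) : toCube x ∈ closedCube s := fun _ _ =>
  ⟨le_max_left _ _, max_le zero_le_one (min_le_left _ _)⟩

theorem toCube_of_mem {x : Fin s → ℝ} (hx : x ∈ closedCube s) : toCube x = x := by
  ext j
  have := hx j trivial
  simp [toCube, this.1, this.2]

theorem toCube_update (x : Fin s → ℝ) (j : Fin s) {t : ℝ} (ht : t ∈ Set.Icc (0 : ℝ) 1) :
    toCube (Function.update x j t) = Function.update (toCube x) j t := by
  ext i
  by_cases h : i = j
  · subst h; simp [toCube, ht.1, ht.2]
  · simp [toCube, h]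

theorem continuous_toCube : Continuous (toCube (s := s)) := by
  unfold toCube
  fun_prop

theorem measurable_enorm_comp_toCube {g : (Fin s → ℝ) → ℝ} (hg : SmoothOnCube g) :
    Measurable fun x => ‖g (toCube x)‖ₑ :=
  (hg.continuousOn.comp_continuous continuous_toCube toCube_mem).measurable.enorm

theorem enorm_comp_toCube_le {g : (Fin s → ℝ) → ℝ} (hg : SmoothOnCube g) (j : Fin s)
    (x : Fin s → ℝ) :
    ‖g (toCube x)‖ₑ ≤ (∫⁻ t in Set.Icc (0 : ℝ) 1, ‖g (toCube (Function.update x j t))‖ₑ) +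
      ∫⁻ t in Set.Icc (0 : ℝ) 1, ‖partialDeriv j g (toCube (Function.update x j t))‖ₑ := by
  have hmaps : Set.MapsTo (fun t => Function.update (toCube x) j t) (Set.Icc 0 1) (closedCube s) :=
    fun t ht => update_mem_closedCube (toCube_mem x) j ht
  have hc : ContDiffOn ℝ 1 (fun t => g (Function.update (toCube x) j t)) (Set.Icc 0 1) :=
    (hg.of_le (by exact_mod_cast le_top)).comp (contDiff_update 1 (toCube x) j).contDiffOn hmaps
  have hx : toCube x j ∈ Set.Icc (0 : ℝ) 1 := toCube_mem x j trivial
  have h := enorm_le_lintegral_add_lintegral_derivWithin hc hx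
  simp only [Function.update_eq_self] at h
  refine h.trans_eq ?_
  congr 1
  · refine setLIntegral_congr_fun measurableSet_Icc fun t ht => ?_
    simp only [toCube_update x j ht]
  · refine setLIntegral_congr_fun measurableSet_Icc fun t ht => ?_
    simp only [toCube_update x j ht]
    rw [(hg.hasDerivWithinAt_comp (hasDerivAt_update (toCube x) j t).hasDerivWithinAt hmaps
      ht).derivWithin (uniqueDiffOn_Icc zero_lt_one t ht)]

/-- Sobolev embedding of the unit ball of `S_{s,u}` into the continuous functions, for all
derivatives at once. -/
theorem abs_mixedDeriv_le {u : Fin s → ℝ} (hu : ∀ j, 0 < u j) {f : (Fin s → ℝ) → ℝ}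
    (hf : SmoothOnCube f)
    (hint : ∀ α, ∫⁻ x in closedCube s, ‖mixedDeriv α f x‖ₑ ≤ ENNReal.ofReal (∏ j, u j ^ α j))
    (α : Fin s → ℕ) {x : Fin s → ℝ} (hx : x ∈ closedCube s) :
    |mixedDeriv α f x| ≤ (∏ j, (1 + u j)) * ∏ j, u j ^ α j := by
  set μ : Fin s → Measure ℝ := fun _ => volume.restrict (Set.Icc 0 1) with hμ
  -- Coordinates in `v` are evaluated pointwise, the others integrated: `v = ∅` is the L¹
  -- hypothesis, `v = univ` the sup bound. Freeing coordinate `j` costs one derivative in direction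
  -- `j`, hence the factor `1 + u j`. Composition with `toCube` makes the integrand measurable on
  -- the whole space.
  have key : ∀ v : Finset (Fin s), ∀ α : Fin s → ℕ, ∀ x,
      (∫⋯∫⁻_vᶜ, (fun x => ‖mixedDeriv α f (toCube x)‖ₑ) ∂μ) x ≤
        ENNReal.ofReal ((∏ j ∈ v, (1 + u j)) * ∏ j, u j ^ α j) := by
    intro v
    induction v using Finset.induction with
    | empty =>
      intro α x
      rw [Finset.compl_empty, lmarginal_univ, hμ, ← Measure.restrict_pi_pi]
      refine le_trans (le_of_eq ?_) ((hint α).trans_eq (by simp))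
      refine setLIntegral_congr_fun (MeasurableSet.univ_pi fun _ => measurableSet_Icc)
        fun y hy => ?_
      simp only [toCube_of_mem (s := s) hy]
    | insert j v hj ih =>
      intro α x
      have hjc : j ∉ (insert j v)ᶜ := by simp
      have hins : insert j (insert j v)ᶜ = vᶜ := by
        ext i; by_cases h : i = j <;> simp [h, hj]
      have hpt : (fun x => ‖mixedDeriv α f (toCube x)‖ₑ) ≤
          fun x => (∫⁻ t, ‖mixedDeriv α f (toCube (Function.update x j t))‖ₑ ∂μ j) +
            ∫⁻ t, ‖mixedDeriv (α + Pi.single j 1) f (toCube (Function.update x j t))‖ₑ ∂μ j := by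
        intro y
        refine (enorm_comp_toCube_le (hf.mixedDeriv α) j y).trans_eq ?_
        congr 1
        refine lintegral_congr fun t => ?_
        rw [mixedDeriv_add_single hf α j (toCube_mem _)]
      refine (lmarginal_mono hpt x).trans ?_
      have hm := fun β => measurable_enorm_comp_toCube (hf.mixedDeriv β)
      have hm' : ∀ β, Measurable fun x : Fin s → ℝ =>
          ∫⁻ t, ‖mixedDeriv β f (toCube (Function.update x j t))‖ₑ ∂μ j := fun β => by
        have := (hm β).lmarginal μ (s := {j})
        rwa [lmarginal_singleton] at this
      have hadd := lintegral_add_left (μ := Measure.pi fun i : ((insert j v)ᶜ : Finset (Fin s)) => μ i)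
        ((hm' α).comp (measurable_updateFinset (x := x) (s := (insert j v)ᶜ)))
        ((fun x : Fin s → ℝ => ∫⁻ t,
          ‖mixedDeriv (α + Pi.single j 1) f (toCube (Function.update x j t))‖ₑ ∂μ j) ∘
            Function.updateFinset x (insert j v)ᶜ)
      refine (le_of_eq hadd).trans ?_
      have h1 := fun β => congrFun (lmarginal_insert' (μ := μ) _ (hm β) hjc) x
      rw [hins] at h1
      have h2 : ENNReal.ofReal ((∏ j ∈ insert j v, (1 + u j)) * ∏ j, u j ^ α j) =
          ENNReal.ofReal ((∏ j ∈ v, (1 + u j)) * ∏ j, u j ^ α j) +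
          ENNReal.ofReal ((∏ j ∈ v, (1 + u j)) * ∏ i, u i ^ (α + Pi.single j 1 : Fin s → ℕ) i) := by
        have hpos : ∀ β : Fin s → ℕ, 0 ≤ (∏ j ∈ v, (1 + u j)) * ∏ j, u j ^ β j := fun β =>
          mul_nonneg (Finset.prod_nonneg fun i _ => by linarith [hu i])
            (Finset.prod_nonneg fun i _ => pow_nonneg (hu i).le _)
        rw [← ENNReal.ofReal_add (hpos _) (hpos _), Finset.prod_insert hj]
        congr 1
        simp only [Pi.add_apply, pow_add, Finset.prod_mul_distrib]
        rw [show ∏ i, u i ^ (Pi.single j 1 : Fin s → ℕ) i = u j by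
          rw [Finset.prod_eq_single j] <;> simp +contextual]
        ring
      rw [h2]
      refine add_le_add ((le_of_eq (h1 α).symm).trans (ih α x))
        ((le_of_eq (h1 (α + Pi.single j 1)).symm).trans (ih _ x))
  have h := key Finset.univ α x
  rw [Finset.compl_univ, lmarginal_empty] at h
  simp only [toCube_of_mem hx] at h
  rw [← Real.norm_eq_abs]
  rw [← ofReal_norm] at h
  exact (ENNReal.ofReal_le_ofReal_iff (mul_nonneg (Finset.prod_nonneg fun i _ => by linarith [hu i])
            (Finset.prod_nonneg fun i _ => pow_nonneg (hu i).le _))).mp h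

end Cube

/-! ### Mixed differences and Lipschitz bounds. -/

/-- A mixed difference of a smooth function, possibly with several steps in the same direction, is
controlled by the corresponding mixed derivative. -/
theorem abs_sum_powerset_mixedDeriv_le {s : ℕ} {f : (Fin s → ℝ) → ℝ} (hf : SmoothOnCube f)
    {u : Fin s → ℝ} {K : ℝ}
    (hK : ∀ α, ∀ x ∈ closedCube s, |mixedDeriv α f x| ≤ K * ∏ j, u j ^ α j)
    {ι : Type*} [DecidableEq ι] (j : ι → Fin s) (h : ι → ℝ) (A : Finset ι) :
    ∀ (α : Fin s → ℕ) (x : Fin s → ℝ),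
      (∀ B ⊆ A, x + ∑ i ∈ B, h i • Pi.single (j i) (1 : ℝ) ∈ closedCube s) →
      |∑ B ∈ A.powerset, (-1) ^ (A.card - B.card) *
          mixedDeriv α f (x + ∑ i ∈ B, h i • Pi.single (j i) (1 : ℝ))| ≤
        K * (∏ j, u j ^ α j) * ∏ i ∈ A, (u (j i) * |h i|) := by
  induction A using Finset.induction with
  | empty =>
    intro α x hx
    simpa using hK α x (by simpa using hx ∅ le_rfl)
  | insert k A hk ih =>
    intro α x hx
    rw [sum_powerset_insert_neg_one hk]
    set c : Finset ι → Fin s → ℝ := fun B => ∑ i ∈ B, h i • Pi.single (j i) (1 : ℝ)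
    set e : Fin s → ℝ := Pi.single (j k) 1 with he
    -- The step `h k` is made a variable `t`. The derivative of `φ` is the difference over `A` with
    -- `α` raised at `j k`, so the induction hypothesis and the mean value inequality apply.
    set φ : ℝ → ℝ := fun t => ∑ B ∈ A.powerset, (-1) ^ (A.card - B.card) *
      mixedDeriv α f ((x + t • e) + c B)
    -- Such a point lies between two vertices that are in the cube by hypothesis.
    have hmem : ∀ t ∈ Set.uIcc 0 (h k), ∀ B ⊆ A, (x + t • e) + c B ∈ closedCube s := by
      intro t ht B hB i _
      have h0 := hx B (hB.trans (Finset.subset_insert _ _)) i trivial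
      have h1 := hx (insert k B) (Finset.insert_subset_insert k hB) i trivial
      rw [Finset.sum_insert fun h => hk (hB h)] at h1
      simp only [Pi.add_apply, Pi.smul_apply, Set.mem_Icc, smul_eq_mul] at h0 h1 ⊢
      by_cases hi : i = j k
      · subst hi
        simp only [he, Pi.single_eq_same, mul_one] at h1 ⊢
        rcases le_total 0 (h k) with h' | h'
        · rw [Set.uIcc_of_le h'] at ht
          constructor <;> linarith [ht.1, ht.2, h0.1, h0.2, h1.1, h1.2]
        · rw [Set.uIcc_of_ge h'] at ht
          constructor <;> linarith [ht.1, ht.2, h0.1, h0.2, h1.1, h1.2]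
      · simpa only [he, Pi.single_eq_of_ne hi, mul_zero, add_zero] using h0
    have hderiv : ∀ t ∈ Set.uIcc 0 (h k), HasDerivWithinAt φ
        (∑ B ∈ A.powerset, (-1) ^ (A.card - B.card) *
          mixedDeriv (α + Pi.single (j k) 1) f ((x + t • e) + c B)) (Set.uIcc 0 (h k)) t := by
      intro t ht
      refine HasDerivWithinAt.fun_sum fun B hB => HasDerivWithinAt.const_mul _ ?_
      have hB' := Finset.mem_powerset.mp hB
      rw [mixedDeriv_add_single hf α (j k) (hmem t ht B hB')]
      refine (hf.mixedDeriv α).hasDerivWithinAt_comp (γ := fun t => (x + t • e) + c B) ?_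
        (fun t ht => hmem t ht B hB') ht
      have := ((hasDerivWithinAt_id t (Set.uIcc 0 (h k))).smul_const e).const_add x |>.add_const (c B)
      simpa using this
    have hbound : ∀ t ∈ Set.uIcc 0 (h k), ‖∑ B ∈ A.powerset, (-1) ^ (A.card - B.card) *
          mixedDeriv (α + Pi.single (j k) 1) f ((x + t • e) + c B)‖ ≤
        K * (∏ i, u i ^ (α + Pi.single (j k) 1 : Fin s → ℕ) i) * ∏ i ∈ A, (u (j i) * |h i|) :=
      fun t ht => ih _ _ (hmem t ht)
    have hmvt := Convex.norm_image_sub_le_of_norm_hasDerivWithin_le hderiv hbound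
      (convex_uIcc 0 (h k)) Set.left_mem_uIcc Set.right_mem_uIcc
    have hφ1 : φ (h k) = ∑ B ∈ A.powerset, (-1) ^ (A.card - B.card) *
        mixedDeriv α f (x + c (insert k B)) := by
      refine Finset.sum_congr rfl fun B hB => ?_
      have : c (insert k B) = h k • e + c B :=
        Finset.sum_insert fun h => hk (Finset.mem_powerset.mp hB h)
      rw [this, add_assoc]
    have hφ0 : φ 0 = ∑ B ∈ A.powerset, (-1) ^ (A.card - B.card) * mixedDeriv α f (x + c B) := by
      simp [φ]
    rw [hφ0, hφ1, Real.norm_eq_abs, sub_zero, Real.norm_eq_abs] at hmvt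
    refine hmvt.trans_eq ?_
    rw [Finset.prod_insert hk]
    simp only [Pi.add_apply, pow_add, Finset.prod_mul_distrib]
    rw [show ∏ i, u i ^ (Pi.single (j k) 1 : Fin s → ℕ) i = u (j k) by
      rw [Finset.prod_eq_single (j k)] <;> simp +contextual]
    ring

/-- Smooth functions on the cube are Lipschitz with respect to the maximum norm. -/
theorem SmoothOnCube.abs_sub_le {s : ℕ} {f : (Fin s → ℝ) → ℝ} (hf : SmoothOnCube f)
    {C : Fin s → ℝ} (hC : ∀ j, ∀ x ∈ closedCube s, |SmoothIntegration.partialDeriv j f x| ≤ C j)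
    {x y : Fin s → ℝ} (hx : x ∈ closedCube s) (hy : y ∈ closedCube s) :
    |f y - f x| ≤ (∑ j, C j) * ‖y - x‖ := by
  refine Convex.norm_image_sub_le_of_norm_hasFDerivWithin_le
    (fun z hz => ((hf.differentiableOn (by simp)) z hz).hasFDerivWithinAt) (fun z hz => ?_)
    convex_closedCube hx hy
  have hC0 : ∀ j, 0 ≤ C j := fun j => (abs_nonneg _).trans (hC j z hz)
  refine ContinuousLinearMap.opNorm_le_bound _ (Finset.sum_nonneg fun j _ => hC0 j) fun v => ?_
  have hv : v = ∑ j, v j • Pi.single j (1 : ℝ) := by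
    ext i
    simp [Finset.sum_apply, Pi.single_apply]
  conv_lhs => rw [hv]
  rw [map_sum, Finset.sum_mul]
  refine (norm_sum_le _ _).trans (Finset.sum_le_sum fun j _ => ?_)
  rw [map_smul, norm_smul, mul_comm]
  exact mul_le_mul (hC j z hz) (norm_le_pi_norm v j) (norm_nonneg _) (hC0 j)

/-! ### Digit expansions and elementary boxes. -/

/-- The residues modulo `b`, identified with `Fin b` through `ZMod.val`. -/
def zmodEquivFin (b : ℕ) [NeZero b] : ZMod b ≃ Fin b where
  toFun c := ⟨c.val, c.val_lt⟩
  invFun k := ((k : ℕ) : ZMod b)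
  left_inv c := ZMod.natCast_zmod_val c
  right_inv k := Fin.ext (ZMod.val_natCast_of_lt k.2)

theorem sum_digitVec (b d : ℕ) [NeZero b] (H : (Fin d → ZMod b) → ℝ) :
    ∑ k : Fin (b ^ d), H (digitVec b d k) = ∑ x, H x := by
  let e : Fin (b ^ d) ≃ (Fin d → ZMod b) :=
    finFunctionFinEquiv.symm.trans (Equiv.piCongrRight fun _ => (zmodEquivFin b).symm)
  rw [← Equiv.sum_comp e]
  refine Finset.sum_congr rfl fun k _ => ?_
  congr 1

/-- The points of a digit expansion, as integers. -/
def digitEquiv (b l : ℕ) [NeZero b] : (Fin l → ZMod b) ≃ Fin (b ^ l) :=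
  (Equiv.arrowCongr Fin.revPerm (zmodEquivFin b)).trans finFunctionFinEquiv

/-- The reversal in `digitEquiv` is needed because `finFunctionFinEquiv` puts the least significant
digit first, whereas digit `0` of a point is the most significant. -/
theorem digitEquiv_div (b l : ℕ) [NeZero b] (c : Fin l → ZMod b) :
    ((digitEquiv b l c : ℕ) : ℝ) / (b : ℝ) ^ l =
      ∑ i : Fin l, ((c i).val : ℝ) / (b : ℝ) ^ ((i : ℕ) + 1) := by
  have hb : (b : ℝ) ≠ 0 := by exact_mod_cast NeZero.ne b
  have h : (digitEquiv b l c : ℕ) = ∑ i : Fin l, (c i).val * b ^ (Fin.rev i : ℕ) := by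
    simp only [digitEquiv, Equiv.trans_apply, finFunctionFinEquiv_apply]
    rw [← Equiv.sum_comp Fin.revPerm]
    refine Finset.sum_congr rfl fun i _ => ?_
    simp [zmodEquivFin, Equiv.arrowCongr]
  rw [h]
  push_cast
  rw [Finset.sum_div]
  refine Finset.sum_congr rfl fun i _ => ?_
  have hi : l = (i : ℕ) + 1 + (Fin.rev i : ℕ) := by
    rw [Fin.val_rev]; omega
  rw [div_eq_div_iff (pow_ne_zero _ hb) (pow_ne_zero _ hb)]
  conv_rhs => rw [hi, pow_add]
  ring

/-- The point of `[0,1)^s` with given base-`b` digits. -/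
def digitPoint {b s l : ℕ} (y : Fin s × Fin l → ZMod b) : Fin s → ℝ :=
  fun j => ∑ i : Fin l, ((y (j, i)).val : ℝ) / (b : ℝ) ^ ((i : ℕ) + 1)

theorem digitalNet_eq {b s l d : ℕ} (M : Matrix (Fin s × Fin l) (Fin d) (ZMod b)) (k : Fin (b ^ d)) :
    digitalNet (fun j => Matrix.of fun i => M (j, i)) k =
      digitPoint (M.mulVec (digitVec b d k)) := rfl

section Digits

variable {b s l : ℕ} [NeZero b]

theorem digitPoint_eq (y : Fin s × Fin l → ZMod b) (j : Fin s) :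
    digitPoint y j = ((digitEquiv b l fun i => y (j, i) : ℕ) : ℝ) / (b : ℝ) ^ l :=
  (digitEquiv_div b l _).symm

theorem digitPoint_nonneg (y : Fin s × Fin l → ZMod b) (j : Fin s) : 0 ≤ digitPoint y j := by
  rw [digitPoint_eq]; positivity

theorem digitPoint_add_le (y : Fin s × Fin l → ZMod b) (j : Fin s) :
    digitPoint y j + ((b : ℝ) ^ l)⁻¹ ≤ 1 := by
  have hb : 0 < (b : ℝ) ^ l := pow_pos (by exact_mod_cast Nat.pos_of_ne_zero (NeZero.ne b)) l
  rw [digitPoint_eq, ← one_div, ← add_div, div_le_one hb]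
  exact_mod_cast (digitEquiv b l fun i => y (j, i)).2

theorem digitPoint_mem_cube (y : Fin s × Fin l → ZMod b) : digitPoint y ∈ cube s := fun j _ => by
  have hb : 0 < ((b : ℝ) ^ l)⁻¹ :=
    inv_pos.mpr (pow_pos (by exact_mod_cast Nat.pos_of_ne_zero (NeZero.ne b)) l)
  exact ⟨digitPoint_nonneg y j, by linarith [digitPoint_add_le y j]⟩

theorem cube_subset_closedCube : cube s ⊆ closedCube s :=
  Set.pi_mono fun _ _ => Set.Ico_subset_Icc_self

/-- Replacing digits causes no carries, so digit changes are independent axis-parallel steps, as in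
`abs_sum_powerset_mixedDeriv_le`. -/
theorem digitPoint_piecewise (B : Finset (Fin s × Fin l)) (y z : Fin s × Fin l → ZMod b) :
    digitPoint (B.piecewise y z) = digitPoint z +
      ∑ i ∈ B, ((((y i).val : ℝ) - (z i).val) / (b : ℝ) ^ ((i.2 : ℕ) + 1)) •
        Pi.single i.1 (1 : ℝ) := by
  ext j
  have h : (∑ i ∈ B, ((((y i).val : ℝ) - (z i).val) / (b : ℝ) ^ ((i.2 : ℕ) + 1)) •
        (Pi.single i.1 (1 : ℝ) : Fin s → ℝ)) j =
      ∑ a : Fin l, if (j, a) ∈ B then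
        ((((y (j, a)).val : ℝ) - (z (j, a)).val) / (b : ℝ) ^ ((a : ℕ) + 1)) else 0 := by
    simp only [Finset.sum_apply, Pi.smul_apply, smul_eq_mul]
    rw [← Finset.sum_ite_mem_eq B, Fintype.sum_prod_type, Finset.sum_eq_single j]
    · simp
    · intro k _ hk
      simp [Ne.symm hk]
    · simp
  rw [Pi.add_apply, h]
  simp only [digitPoint]
  rw [← Finset.sum_add_distrib]
  refine Finset.sum_congr rfl fun a _ => ?_
  by_cases ha : (j, a) ∈ B
  · simp [ha, sub_div]
  · simp [ha]

/-- The elementary box of points of `[0,1)^s` with prescribed leading digits. -/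
def digitBox (y : Fin s × Fin l → ZMod b) : Set (Fin s → ℝ) :=
  Set.univ.pi fun j => Set.Ico (digitPoint y j) (digitPoint y j + ((b : ℝ) ^ l)⁻¹)

theorem mem_digitBox_iff {y : Fin s × Fin l → ZMod b} {x : Fin s → ℝ} :
    x ∈ digitBox y ↔ ∀ j, ((digitEquiv b l fun i => y (j, i) : ℕ) : ℝ) ≤ x j * (b : ℝ) ^ l ∧
      x j * (b : ℝ) ^ l < ((digitEquiv b l fun i => y (j, i) : ℕ) : ℝ) + 1 := by
  have hb : 0 < (b : ℝ) ^ l := pow_pos (by exact_mod_cast Nat.pos_of_ne_zero (NeZero.ne b)) l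
  simp only [digitBox, Set.mem_univ_pi, Set.mem_Ico, digitPoint_eq]
  refine forall_congr' fun j => and_congr (div_le_iff₀ hb) ?_
  rw [← one_div, ← add_div, lt_div_iff₀ hb]

theorem iUnion_digitBox : ⋃ y : Fin s × Fin l → ZMod b, digitBox y = cube s := by
  have hb : 0 < (b : ℝ) ^ l := pow_pos (by exact_mod_cast Nat.pos_of_ne_zero (NeZero.ne b)) l
  refine Set.Subset.antisymm (Set.iUnion_subset fun y x hx j _ => ?_) fun x hx => ?_
  · have := hx j trivial
    exact ⟨(digitPoint_nonneg y j).trans this.1, this.2.trans_le (digitPoint_add_le y j)⟩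
  · have hx' : ∀ j, 0 ≤ x j * (b : ℝ) ^ l ∧ x j * (b : ℝ) ^ l < (b : ℝ) ^ l := fun j => by
      have := hx j trivial
      exact ⟨mul_nonneg this.1 hb.le, by nlinarith [this.2]⟩
    have hlt : ∀ j, ⌊x j * (b : ℝ) ^ l⌋₊ < b ^ l := fun j =>
      (Nat.floor_lt (hx' j).1).mpr (by exact_mod_cast (hx' j).2)
    refine Set.mem_iUnion.mpr
      ⟨fun q => (digitEquiv b l).symm ⟨⌊x q.1 * (b : ℝ) ^ l⌋₊, hlt q.1⟩ q.2, ?_⟩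
    rw [mem_digitBox_iff]
    intro j
    change ((digitEquiv b l ((digitEquiv b l).symm ⟨⌊x j * (b : ℝ) ^ l⌋₊, hlt j⟩) : ℕ) : ℝ) ≤ _ ∧
      _ < ((digitEquiv b l ((digitEquiv b l).symm ⟨⌊x j * (b : ℝ) ^ l⌋₊, hlt j⟩) : ℕ) : ℝ) + 1
    rw [Equiv.apply_symm_apply]
    exact ⟨Nat.floor_le (hx' j).1, Nat.lt_floor_add_one _⟩

theorem pairwise_disjoint_digitBox :
    Pairwise (Function.onFun Disjoint (digitBox : (Fin s × Fin l → ZMod b) → Set (Fin s → ℝ))) := by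
  intro y y' hne
  refine Set.disjoint_left.mpr fun x hx hx' => hne ?_
  rw [mem_digitBox_iff] at hx hx'
  ext ⟨j, i⟩
  have h1 : (digitEquiv b l fun i => y (j, i) : ℕ) < (digitEquiv b l fun i => y' (j, i) : ℕ) + 1 := by
    exact_mod_cast (hx j).1.trans_lt (hx' j).2
  have h2 : (digitEquiv b l fun i => y' (j, i) : ℕ) < (digitEquiv b l fun i => y (j, i) : ℕ) + 1 := by
    exact_mod_cast (hx' j).1.trans_lt (hx j).2
  have h3 : (digitEquiv b l fun i => y (j, i)) = digitEquiv b l fun i => y' (j, i) :=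
    Fin.ext (by omega)
  rw [congrFun ((digitEquiv b l).injective h3) i]

theorem volume_real_digitBox (y : Fin s × Fin l → ZMod b) :
    volume.real (digitBox y) = ((Fintype.card (Fin s × Fin l → ZMod b) : ℕ) : ℝ)⁻¹ := by
  have hb : 0 ≤ ((b : ℝ) ^ l)⁻¹ := by positivity
  rw [measureReal_def, digitBox, Real.volume_pi_Ico, ENNReal.toReal_prod]
  simp [ENNReal.toReal_ofReal hb, ZMod.card, mul_comm s l, pow_mul]

/-- The mean over all points with `l` digits, compared to the integral. -/
theorem abs_integral_sub_mean_digitPoint_le {f : (Fin s → ℝ) → ℝ} (hf : SmoothOnCube f) {L : ℝ}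
    (hL : 0 ≤ L) (hLip : ∀ x ∈ closedCube s, ∀ y ∈ closedCube s, |f y - f x| ≤ L * ‖y - x‖) :
    |integral f - (∑ y : Fin s × Fin l → ZMod b, f (digitPoint y)) /
      (Fintype.card (Fin s × Fin l → ZMod b) : ℝ)| ≤ L / (b : ℝ) ^ l := by
  set N : ℝ := (Fintype.card (Fin s × Fin l → ZMod b) : ℝ) with hN
  have hNpos : 0 < N := by rw [hN]; exact_mod_cast Fintype.card_pos
  have hmeas : ∀ y : Fin s × Fin l → ZMod b, MeasurableSet (digitBox y) := fun y =>
    MeasurableSet.univ_pi fun _ => measurableSet_Ico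
  have hsub : ∀ y : Fin s × Fin l → ZMod b, digitBox y ⊆ cube s := fun y => by
    rw [← iUnion_digitBox (b := b) (l := l)]
    exact Set.subset_iUnion digitBox y
  have hint : IntegrableOn f (closedCube s) :=
    hf.continuousOn.integrableOn_compact (isCompact_univ_pi fun _ => isCompact_Icc)
  have hintb : ∀ y : Fin s × Fin l → ZMod b, IntegrableOn f (digitBox y) := fun y =>
    hint.mono_set ((hsub y).trans cube_subset_closedCube)
  have hfin : ∀ y : Fin s × Fin l → ZMod b, volume (digitBox y) < ∞ := fun y => by
    rw [digitBox, Real.volume_pi_Ico]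
    exact ENNReal.prod_lt_top fun _ _ => ENNReal.ofReal_lt_top
  have h1 : integral f = ∑ y : Fin s × Fin l → ZMod b, ∫ x in digitBox y, f x := by
    rw [integral, ← iUnion_digitBox (b := b) (l := l),
      integral_iUnion_fintype hmeas pairwise_disjoint_digitBox hintb]
  have h2 : ∀ y : Fin s × Fin l → ZMod b, |(∫ x in digitBox y, f x) - f (digitPoint y) / N| ≤
      L / (b : ℝ) ^ l * N⁻¹ := by
    intro y
    have h3 : f (digitPoint y) / N = ∫ _ in digitBox y, f (digitPoint y) := by
      rw [setIntegral_const, volume_real_digitBox, smul_eq_mul, div_eq_inv_mul]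
    rw [h3, ← integral_sub (hintb y) (integrableOn_const (hfin y).ne), ← volume_real_digitBox y,
      ← Real.norm_eq_abs]
    refine norm_setIntegral_le_of_norm_le_const (hfin y) fun x hx => ?_
    refine (hLip _ (cube_subset_closedCube (digitPoint_mem_cube y)) x
      (cube_subset_closedCube (hsub y hx))).trans ?_
    rw [div_eq_mul_inv]
    refine mul_le_mul_of_nonneg_left ((pi_norm_le_iff_of_nonneg (by positivity)).mpr fun j => ?_) hL
    have := hx j trivial
    rw [Pi.sub_apply, Real.norm_eq_abs, abs_le]
    constructor
    · have : (0 : ℝ) ≤ ((b : ℝ) ^ l)⁻¹ := by positivity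
      linarith [(hx j trivial).1]
    · linarith [this.2]
  rw [h1, Finset.sum_div, ← Finset.sum_sub_distrib]
  refine (Finset.abs_sum_le_sum_abs _ _).trans ((Finset.sum_le_sum fun y _ => h2 y).trans_eq ?_)
  rw [Finset.sum_const, Finset.card_univ, nsmul_eq_mul, ← hN]
  field_simp

end Digits

theorem qmcRule_digitalNet {b s l d : ℕ} [NeZero b] (M : Matrix (Fin s × Fin l) (Fin d) (ZMod b))
    (f : (Fin s → ℝ) → ℝ) :
    qmcRule (digitalNet fun j => Matrix.of fun i => M (j, i)) f =
      (∑ x, f (digitPoint (M.mulVec x))) / (b : ℝ) ^ d := by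
  simp only [qmcRule, digitalNet_eq]
  rw [sum_digitVec b d fun x => f (digitPoint (M.mulVec x))]
  push_cast
  rfl

/-! ### Worst-case error of a digital net. -/

section WorstCase

variable {u : ℕ → ℝ} {s : ℕ}

theorem abs_mixedDeriv_le_of_sNorm_le_one (hu : ∀ j, 0 < u j) {f : (Fin s → ℝ) → ℝ}
    (hf : f ∈ sSpace u s) (h1 : sNorm u f ≤ 1) (α : Fin s → ℕ) {x : Fin s → ℝ}
    (hx : x ∈ closedCube s) :
    |mixedDeriv α f x| ≤ (∏ j : Fin s, (1 + u j)) * ∏ j : Fin s, u j ^ α j := by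
  refine abs_mixedDeriv_le (u := fun j : Fin s => u j) (fun j => hu j) hf.1 (fun β => ?_) α hx
  have h := (le_iSup (fun α : Fin s → ℕ => (∫⁻ x in closedCube s, ‖mixedDeriv α f x‖ₑ) /
    ENNReal.ofReal (∏ j : Fin s, u j ^ α j)) β).trans h1
  rwa [ENNReal.div_le_iff (by
    simpa using Finset.prod_pos fun j (_ : j ∈ Finset.univ) => pow_pos (hu (j : Fin s)) (β j))
    ENNReal.ofReal_ne_top, one_mul] at h

theorem worstCaseError_le {A : ((Fin s → ℝ) → ℝ) → ℝ} {ε : ℝ}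
    (h : ∀ f ∈ sSpace u s, sNorm u f ≤ 1 → |integral f - A f| ≤ ε) :
    worstCaseError u A ≤ ENNReal.ofReal ε :=
  iSup₂_le fun f hf => ENNReal.ofReal_le_ofReal (h f hf.1 hf.2)

/-- A weight-only bound for quadrature errors, valid for every net. -/
theorem worstCaseError_digitalNet_le_two_mul (hu : ∀ j, 0 < u j) {b l d : ℕ} [NeZero b]
    (M : Matrix (Fin s × Fin l) (Fin d) (ZMod b)) :
    worstCaseError u (qmcRule (digitalNet fun j => Matrix.of fun i => M (j, i))) ≤
      ENNReal.ofReal (2 * ∏ j : Fin s, (1 + u j)) := by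
  refine worstCaseError_le fun f hf h1 => ?_
  set K := ∏ j : Fin s, (1 + u j)
  have hK : ∀ x ∈ cube s, |f x| ≤ K := fun x hx => by
    simpa [mixedDeriv_zero] using
      abs_mixedDeriv_le_of_sNorm_le_one hu hf h1 0 (cube_subset_closedCube hx)
  have hb : (0 : ℝ) < (b : ℝ) ^ d := pow_pos (by exact_mod_cast Nat.pos_of_ne_zero (NeZero.ne b)) d
  have hvol : volume (cube s) = 1 := by
    have := Real.volume_pi_Ico (a := fun _ : Fin s => (0 : ℝ)) (b := fun _ => 1)
    simpa [cube] using this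
  have h2 : |integral f| ≤ K := by
    have := norm_setIntegral_le_of_norm_le_const (μ := volume) (s := cube s) (f := f) (C := K)
      (by simp [hvol]) hK
    simpa [integral, measureReal_def, hvol] using this
  have h3 : |qmcRule (digitalNet fun j => Matrix.of fun i => M (j, i)) f| ≤ K := by
    rw [qmcRule_digitalNet, abs_div, abs_of_pos hb, div_le_iff₀ hb]
    refine (Finset.abs_sum_le_sum_abs _ _).trans
      ((Finset.sum_le_card_nsmul _ _ K fun x _ => hK _ (digitPoint_mem_cube _)).trans_eq ?_)
    simp [ZMod.card, mul_comm]
  calc _ ≤ |integral f| + |qmcRule (digitalNet fun j => Matrix.of fun i => M (j, i)) f| :=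
        abs_sub _ _
    _ ≤ 2 * K := by linarith

/-- The worst-case error of a digital net whose generating matrices are of full rank along the
members of a family of sets of digit positions. -/
theorem worstCaseError_digitalNet_le (hu : ∀ j, 0 < u j) {b l d : ℕ} [NeZero b]
    (M : Matrix (Fin s × Fin l) (Fin d) (ZMod b)) (F : Finset (Finset (Fin s × Fin l)))
    (hM : ∀ A ∈ F, ∀ y : Fin s × Fin l → ZMod b, ∃ x, ∀ i ∈ A, M.mulVec x i = y i)
    (hF : ∅ ∈ F) :
    worstCaseError u (qmcRule (digitalNet fun j => Matrix.of fun i => M (j, i))) ≤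
      ENNReal.ofReal ((∏ j : Fin s, (1 + u j)) * ((∑ j : Fin s, u j) / (b : ℝ) ^ l +
        ∑ A ∈ Fᶜ, ∏ i ∈ A, u i.1 / (b : ℝ) ^ (i.2 : ℕ))) := by
  refine worstCaseError_le fun f hf h1 => ?_
  set K := ∏ j : Fin s, (1 + u j)
  have hK0 : 0 ≤ K := Finset.prod_nonneg fun j _ => by linarith [hu j]
  have hb : (0 : ℝ) < b := by exact_mod_cast Nat.pos_of_ne_zero (NeZero.ne b)
  have hK := fun α x (hx : x ∈ closedCube s) => abs_mixedDeriv_le_of_sNorm_le_one hu hf h1 α hx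
  have hK1 : ∀ j : Fin s, ∀ x ∈ closedCube s, |partialDeriv j f x| ≤ K * u j := by
    intro j x hx
    have h := hK (0 + Pi.single j 1) x hx
    rw [mixedDeriv_add_single hf.1 0 j hx, mixedDeriv_zero, zero_add,
      Finset.prod_eq_single (f := fun i : Fin s => u i ^ (Pi.single j 1 : Fin s → ℕ) i) j
        (by simp +contextual) (by simp), Pi.single_eq_same, pow_one] at h
    exact h
  have hgrid := abs_integral_sub_mean_digitPoint_le (b := b) (l := l) hf.1
    (L := ∑ j : Fin s, K * u j) (Finset.sum_nonneg fun j _ => mul_nonneg hK0 (hu j).le)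
    (fun x hx y hy => SmoothOnCube.abs_sub_le hf.1 hK1 hx hy)
  -- Two digits differ by at most `b`, so a step in position `i.2` has length at most `b / b ^ (i.2
  -- + 1)`.
  have hdiff : ∀ (A : Finset (Fin s × Fin l)) (y z : Fin s × Fin l → ZMod b),
      |mixedDiff (fun y => f (digitPoint y)) A y z| ≤
        K * ∏ i ∈ A, u i.1 / (b : ℝ) ^ (i.2 : ℕ) := by
    intro A y z
    have h := abs_sum_powerset_mixedDeriv_le hf.1 (u := fun j => u j) hK
      (fun i : Fin s × Fin l => i.1)
      (fun i => (((y i).val : ℝ) - (z i).val) / (b : ℝ) ^ ((i.2 : ℕ) + 1)) A 0 (digitPoint z)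
      (fun B _ => by
        rw [← digitPoint_piecewise]
        exact cube_subset_closedCube (digitPoint_mem_cube _))
    simp only [← digitPoint_piecewise, mixedDeriv_zero, Pi.zero_apply, pow_zero,
      Finset.prod_const_one, mul_one] at h
    refine h.trans (mul_le_mul_of_nonneg_left (Finset.prod_le_prod
      (fun i _ => mul_nonneg (hu _).le (abs_nonneg _)) fun i _ => ?_) hK0)
    rw [div_eq_mul_inv (u i.1)]
    refine mul_le_mul_of_nonneg_left ?_ (hu _).le
    rw [abs_div, abs_of_pos (pow_pos hb _), div_le_iff₀ (pow_pos hb _), pow_succ,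
      inv_mul_cancel_left₀ (pow_pos hb _).ne', abs_le]
    have h1 : ((y i).val : ℝ) < b := by exact_mod_cast (y i).val_lt
    have h2 : ((z i).val : ℝ) < b := by exact_mod_cast (z i).val_lt
    have h3 : (0 : ℝ) ≤ (y i).val := Nat.cast_nonneg _
    have h4 : (0 : ℝ) ≤ (z i).val := Nat.cast_nonneg _
    constructor <;> linarith
  have hnet := abs_mean_comp_mulVec_sub_mean_le M F hM hF (fun y => f (digitPoint y)) _ hdiff
  rw [← qmcRule_digitalNet] at hnet
  rw [← Finset.mul_sum] at hgrid hnet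
  rw [mul_add, ← mul_div_assoc]
  rw [abs_sub_comm] at hnet
  exact (abs_sub_le _ _ _).trans (add_le_add hgrid hnet)

end WorstCase

/-! ### Counting digit sets and choosing the parameters. -/

/-- Rankin's bound for the number of sets of large weight. -/
theorem sum_pow_card_le_exp {ι : Type*} [Fintype ι] [DecidableEq ι] {θ : ι → ℝ}
    (hθ : ∀ i, 0 < θ i) {b : ℝ} (hb : 0 ≤ b) (T : ℝ) {lam : ℝ} (hlam : 0 < lam)
    (F : Finset (Finset ι)) (hF : ∀ A ∈ F, Real.exp (-T) ≤ ∏ i ∈ A, θ i) :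
    ∑ A ∈ F, b ^ A.card ≤ Real.exp (lam * T + b * ∑ i, θ i ^ lam) := by
  have h1 : ∀ A ∈ F, b ^ A.card ≤ Real.exp (lam * T) * ∏ i ∈ A, (b * θ i ^ lam) := by
    intro A hA
    rw [Finset.prod_mul_distrib, Finset.prod_const, Real.finsetProd_rpow _ _ fun i _ => (hθ i).le]
    have h := Real.rpow_le_rpow (Real.exp_pos _).le (hF A hA) hlam.le
    rw [← Real.exp_mul] at h
    have h2 : 1 ≤ Real.exp (lam * T) * (∏ i ∈ A, θ i) ^ lam := by
      calc (1 : ℝ) = Real.exp (lam * T) * Real.exp (-T * lam) := by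
            rw [← Real.exp_add]; simp [mul_comm]
        _ ≤ _ := by gcongr
    calc b ^ A.card = b ^ A.card * 1 := (mul_one _).symm
      _ ≤ b ^ A.card * (Real.exp (lam * T) * (∏ i ∈ A, θ i) ^ lam) := by gcongr
      _ = _ := by ring
  have hnn : ∀ i, 0 ≤ b * θ i ^ lam := fun i => mul_nonneg hb (Real.rpow_nonneg (hθ i).le _)
  calc ∑ A ∈ F, b ^ A.card ≤ ∑ A ∈ F, Real.exp (lam * T) * ∏ i ∈ A, (b * θ i ^ lam) :=
        Finset.sum_le_sum h1
    _ ≤ ∑ A : Finset ι, Real.exp (lam * T) * ∏ i ∈ A, (b * θ i ^ lam) :=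
        Finset.sum_le_univ_sum_of_nonneg fun A =>
          mul_nonneg (Real.exp_pos _).le (Finset.prod_nonneg fun i _ => hnn i)
    _ = Real.exp (lam * T) * ∏ i, (1 + b * θ i ^ lam) := by
        rw [← Finset.mul_sum, Finset.prod_one_add, Finset.powerset_univ]
    _ ≤ Real.exp (lam * T) * ∏ i, Real.exp (b * θ i ^ lam) := by
        gcongr with i _
        · intro i _; linarith [hnn i]
        · rw [add_comm]; exact Real.add_one_le_exp _
    _ = _ := by rw [← Real.exp_sum, ← Real.exp_add, Finset.mul_sum]

/-- The total weight of the sets of small weight. -/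
theorem sum_prod_le_exp {ι : Type*} [Fintype ι] [DecidableEq ι] {θ : ι → ℝ}
    (hθ : ∀ i, 0 < θ i) (T : ℝ) (F : Finset (Finset ι))
    (hF : ∀ A ∈ F, ∏ i ∈ A, θ i ≤ Real.exp (-T)) :
    ∑ A ∈ F, ∏ i ∈ A, θ i ≤ Real.exp (-(T / 2)) * Real.exp (∑ i, θ i ^ (1 / 2 : ℝ)) := by
  have h1 : ∀ A ∈ F, ∏ i ∈ A, θ i ≤ Real.exp (-(T / 2)) * ∏ i ∈ A, θ i ^ (1 / 2 : ℝ) := by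
    intro A hA
    have hp : 0 < ∏ i ∈ A, θ i := Finset.prod_pos fun i _ => hθ i
    rw [Real.finsetProd_rpow _ _ fun i _ => (hθ i).le]
    have h := Real.rpow_le_rpow hp.le (hF A hA) (by norm_num : (0 : ℝ) ≤ 1 / 2)
    rw [← Real.exp_mul, show -T * (1 / 2) = -(T / 2) by ring] at h
    calc ∏ i ∈ A, θ i = (∏ i ∈ A, θ i) ^ (1 / 2 : ℝ) * (∏ i ∈ A, θ i) ^ (1 / 2 : ℝ) := by
          rw [← Real.rpow_add hp]; norm_num
      _ ≤ _ := mul_le_mul_of_nonneg_right h (Real.rpow_nonneg hp.le _)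
  have hnn : ∀ i, 0 ≤ θ i ^ (1 / 2 : ℝ) := fun i => Real.rpow_nonneg (hθ i).le _
  calc ∑ A ∈ F, ∏ i ∈ A, θ i ≤ ∑ A ∈ F, Real.exp (-(T / 2)) * ∏ i ∈ A, θ i ^ (1 / 2 : ℝ) :=
        Finset.sum_le_sum h1
    _ ≤ ∑ A : Finset ι, Real.exp (-(T / 2)) * ∏ i ∈ A, θ i ^ (1 / 2 : ℝ) :=
        Finset.sum_le_univ_sum_of_nonneg fun A =>
          mul_nonneg (Real.exp_pos _).le (Finset.prod_nonneg fun i _ => hnn i)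
    _ = Real.exp (-(T / 2)) * ∏ i, (1 + θ i ^ (1 / 2 : ℝ)) := by
        rw [← Finset.mul_sum, Finset.prod_one_add, Finset.powerset_univ]
    _ ≤ Real.exp (-(T / 2)) * ∏ i, Real.exp (θ i ^ (1 / 2 : ℝ)) := by
        gcongr with i _
        · intro i _; linarith [hnn i]
        · rw [add_comm]; exact Real.add_one_le_exp _
    _ = _ := by rw [← Real.exp_sum]

/-- The sum factors, with a geometric series of ratio `q = b ^ (-lam)` over the digits. Bernoulli's
inequality gives `1 - q ≥ lam / 2`, hence a bound independent of `l`. -/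
theorem sum_digitWeight_rpow_le {u : ℕ → ℝ} (hu : ∀ j, 0 < u j) {b : ℕ} (hb : 2 ≤ b) (s l : ℕ)
    {lam : ℝ} (h0 : 0 < lam) (h1 : lam ≤ 1) :
    ∑ i : Fin s × Fin l, (u i.1 / (b : ℝ) ^ (i.2 : ℕ)) ^ lam ≤
      2 / lam * ∑ j : Fin s, u j ^ lam := by
  have hb2 : (2 : ℝ) ≤ b := by exact_mod_cast hb
  set q : ℝ := (b : ℝ) ^ (-lam) with hq
  have hq0 : 0 ≤ q := by positivity
  have hq1 : q ≤ 1 - lam / 2 := by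
    have h2 : q ≤ (2 : ℝ) ^ (-lam) :=
      Real.rpow_le_rpow_of_nonpos (by norm_num) hb2 (by linarith)
    have h3 := rpow_one_add_le_one_add_mul_self (s := -1 / 2) (by norm_num) h0.le h1
    have h4 : (2 : ℝ) ^ (-lam) = (1 + -1 / 2) ^ lam := by
      rw [Real.rpow_neg (by norm_num), ← Real.inv_rpow (by norm_num)]; norm_num
    linarith
  have hgeom : ∑ a : Fin l, q ^ (a : ℕ) ≤ 2 / lam := by
    rw [Fin.sum_univ_eq_sum_range fun a => q ^ a]
    have h := geom_sum_mul_neg q l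
    have h2 : (∑ a ∈ Finset.range l, q ^ a) * (lam / 2) ≤ 1 := by
      calc _ ≤ (∑ a ∈ Finset.range l, q ^ a) * (1 - q) := by
            gcongr
            linarith
        _ ≤ 1 := by rw [h]; linarith [pow_nonneg hq0 l]
    rw [le_div_iff₀ h0]
    linarith
  have hterm : ∀ i : Fin s × Fin l, (u i.1 / (b : ℝ) ^ (i.2 : ℕ)) ^ lam =
      u i.1 ^ lam * q ^ (i.2 : ℕ) := by
    intro i
    rw [Real.div_rpow (hu _).le (by positivity), div_eq_mul_inv, hq, ← Real.rpow_natCast,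
      ← Real.rpow_natCast, ← Real.rpow_mul (by positivity), ← Real.rpow_mul (by positivity),
      ← Real.rpow_neg (by positivity)]
    congr 2
    ring
  rw [Finset.sum_congr rfl fun i _ => hterm i, Fintype.sum_prod_type]
  simp only [← Finset.mul_sum]
  rw [← Finset.sum_mul, mul_comm]
  exact mul_le_mul_of_nonneg_right hgeom
    (Finset.sum_nonneg fun j _ => Real.rpow_nonneg (hu _).le _)

/-- Digital nets of `b ^ d` points, for weights whose power sums are bounded by `B` times a power
of the exponent. -/
theorem exists_digitalNet_le_exp_rpow {b : ℕ} (hb : 2 ≤ b) {p : ℝ} (hp1 : 1 < p) {B : ℝ}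
    (hB : 0 < B) : ∃ C c : ℝ, 0 < C ∧ 0 < c ∧
    ∀ (u : ℕ → ℝ) (s : ℕ), (∀ j, 0 < u j) →
      (∀ lam : ℝ, 0 < lam → lam ≤ 1 →
        ∑ j : Fin s, u j ^ lam ≤ B * lam ^ (1 - 1 / (p - 1))) →
      ∀ d : ℕ, ∃ l : ℕ, d ≤ l ∧ ∃ G : Fin s → Matrix (Fin l) (Fin d) (ZMod b),
        worstCaseError u (qmcRule (digitalNet G)) ≤
          ENNReal.ofReal (C * Real.exp (-c * (d : ℝ) ^ p)) := by
  have : NeZero b := ⟨by omega⟩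
  have hb2 : (2 : ℝ) ≤ b := by exact_mod_cast hb
  have hp0 : 0 < p - 1 := by linarith
  -- Chosen so that `lam = L / d ^ (p - 1)` makes `b * ∑ θ ^ lam` at most `d / 4`. Below, `E` bounds
  -- the sum at `lam = 1/2`, and `R` bounds `d ^ p` for those small `d` where this `lam` would
  -- exceed 1; they fall under the trivial error bound.
  set L : ℝ := max 1 ((8 * b * B) ^ (p - 1)) with hL
  have hL1 : 1 ≤ L := le_max_left _ _
  have hL0 : 0 < L := by linarith
  have hLr : 8 * b * B ≤ L ^ (1 / (p - 1)) := by
    have h := Real.rpow_le_rpow (by positivity) (le_max_right 1 ((8 * b * B) ^ (p - 1)))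
      (by positivity : 0 ≤ 1 / (p - 1))
    rwa [← Real.rpow_mul (by positivity), mul_one_div_cancel hp0.ne', Real.rpow_one] at h
  set E : ℝ := 2 * B * (1 / 2 : ℝ) ^ (-(1 / (p - 1)))
  set R : ℝ := L ^ (p / (p - 1))
  refine ⟨Real.exp B * (1 + Real.exp E) + 2 * Real.exp B * Real.exp (1 / (8 * L) * R), 1 / (8 * L),
    by positivity, by positivity, fun u s hu hH d => ?_⟩
  have hsum : ∑ j : Fin s, u j ≤ B := by simpa using hH 1 one_pos le_rfl
  have hK : ∏ j : Fin s, (1 + u j) ≤ Real.exp B := by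
    calc ∏ j : Fin s, (1 + u j) ≤ ∏ j : Fin s, Real.exp (u j) :=
          Finset.prod_le_prod (fun j _ => by linarith [hu j]) fun j _ => by
            rw [add_comm]; exact Real.add_one_le_exp _
      _ = Real.exp (∑ j : Fin s, u j) := (Real.exp_sum _ _).symm
      _ ≤ _ := Real.exp_le_exp.mpr hsum
  have hK0 : 0 ≤ ∏ j : Fin s, (1 + u j) := Finset.prod_nonneg fun j _ => by linarith [hu j]
  have hθsum : ∀ l (lam : ℝ), 0 < lam → lam ≤ 1 →
      ∑ i : Fin s × Fin l, (u i.1 / (b : ℝ) ^ (i.2 : ℕ)) ^ lam ≤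
        2 * B * lam ^ (-(1 / (p - 1))) := by
    intro l lam h0 h1
    refine (sum_digitWeight_rpow_le hu hb s l h0 h1).trans ?_
    calc 2 / lam * ∑ j : Fin s, u j ^ lam ≤ 2 / lam * (B * lam ^ (1 - 1 / (p - 1))) := by
          gcongr
          exact hH lam h0 h1
      _ = _ := by
          rw [sub_eq_add_neg, Real.rpow_add h0, Real.rpow_one]
          field_simp
  by_cases hd : L ≤ (d : ℝ) ^ (p - 1)
  · have hd0 : (0 : ℝ) < d := by
      rcases Nat.eq_zero_or_pos d with rfl | h
      · rw [Nat.cast_zero, Real.zero_rpow hp0.ne'] at hd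
        linarith
      · exact_mod_cast h
    have hdp : 0 < (d : ℝ) ^ (p - 1) := by positivity
    set T : ℝ := (d : ℝ) ^ p / (4 * L)
    set lam : ℝ := L / (d : ℝ) ^ (p - 1)
    have hlam0 : 0 < lam := by positivity
    have hlam1 : lam ≤ 1 := (div_le_one hdp).mpr hd
    have hlamT : lam * T = d / 4 := by
      have : (d : ℝ) ^ p = (d : ℝ) ^ (p - 1) * d := by
        rw [← Real.rpow_add_one hd0.ne']; ring_nf
      simp only [lam, T, this]
      field_simp
    have hlamr : lam ^ (-(1 / (p - 1))) = d / L ^ (1 / (p - 1)) := by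
      rw [Real.rpow_neg hlam0.le, Real.div_rpow hL0.le hdp.le, ← Real.rpow_mul hd0.le,
        mul_one_div_cancel hp0.ne', Real.rpow_one, inv_div]
    -- The precision only has to push the discretization error below `exp (-T / 2)`; no other bound
    -- depends on `l`.
    obtain ⟨l₀, hl₀⟩ := exists_nat_gt (B / Real.exp (-(T / 2)))
    set l := max d l₀
    have hl : B / (b : ℝ) ^ l ≤ Real.exp (-(T / 2)) := by
      have h1 : (l₀ : ℝ) ≤ (b : ℝ) ^ l := by
        have h2 : l < b ^ l := Nat.lt_pow_self (by omega)
        exact_mod_cast (le_max_right d l₀).trans h2.le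
      rw [div_lt_iff₀ (Real.exp_pos _)] at hl₀
      rw [div_le_iff₀ (by positivity), mul_comm]
      exact hl₀.le.trans (mul_le_mul_of_nonneg_right h1 (Real.exp_pos _).le)
    set θ : Fin s × Fin l → ℝ := fun i => u i.1 / (b : ℝ) ^ (i.2 : ℕ)
    have hθ : ∀ i, 0 < θ i := fun i => div_pos (hu _) (by positivity)
    set F : Finset (Finset (Fin s × Fin l)) :=
      Finset.univ.filter fun A => Real.exp (-T) < ∏ i ∈ A, θ i
    have hT : 0 < T := by positivity
    have hcount : ∑ A ∈ F, b ^ A.card < 2 ^ d := by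
      have h1 := sum_pow_card_le_exp hθ (b := b) (by positivity) T hlam0 F
        fun A hA => (Finset.mem_filter.mp hA).2.le
      -- Each term is at most `d / 4`, and `1 / 2 < log 2`.
      have h2 : lam * T + b * ∑ i, θ i ^ lam < d * Real.log 2 := by
        have h3 : b * ∑ i, θ i ^ lam ≤ d / 4 := by
          calc b * ∑ i, θ i ^ lam ≤ b * (2 * B * (d / L ^ (1 / (p - 1)))) := by
                rw [← hlamr]
                gcongr
                exact hθsum l lam hlam0 hlam1
            _ ≤ b * (2 * B * (d / (8 * b * B))) := by gcongr
            _ = d / 4 := by field_simp; norm_num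
        nlinarith [Real.log_two_gt_d9]
      have h3 : Real.exp (lam * T + b * ∑ i, θ i ^ lam) < 2 ^ d := by
        rw [← Real.rpow_natCast, Real.rpow_def_of_pos two_pos, mul_comm (Real.log 2)]
        exact Real.exp_lt_exp.mpr h2
      exact_mod_cast h1.trans_lt h3
    obtain ⟨M, hM⟩ := exists_matrix_surjective hb d F hcount
    refine ⟨l, le_max_left _ _, fun j => Matrix.of fun i => M (j, i),
      (worstCaseError_digitalNet_le hu M F hM (by simp [F, hT])).trans
        (ENNReal.ofReal_le_ofReal ?_)⟩
    have htail : ∑ A ∈ Fᶜ, ∏ i ∈ A, θ i ≤ Real.exp (-(T / 2)) * Real.exp E := by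
      refine (sum_prod_le_exp hθ T Fᶜ fun A hA => ?_).trans ?_
      · simpa [F] using hA
      · gcongr
        exact hθsum l (1 / 2) (by norm_num) (by norm_num)
    have hexp : -(1 / (8 * L)) * (d : ℝ) ^ p = -(T / 2) := by
      simp only [T]; field_simp; norm_num
    rw [hexp]
    calc (∏ j : Fin s, (1 + u j)) * ((∑ j : Fin s, u j) / (b : ℝ) ^ l + ∑ A ∈ Fᶜ, ∏ i ∈ A, θ i)
        ≤ Real.exp B * (Real.exp (-(T / 2)) + Real.exp (-(T / 2)) * Real.exp E) := by
          have h1 : (∑ j : Fin s, u j) / (b : ℝ) ^ l ≤ Real.exp (-(T / 2)) :=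
            (div_le_div_of_nonneg_right hsum (by positivity)).trans hl
          have h2 : 0 ≤ Real.exp (-(T / 2)) + Real.exp (-(T / 2)) * Real.exp E := by positivity
          exact (mul_le_mul_of_nonneg_left (add_le_add h1 htail) hK0).trans
            (mul_le_mul_of_nonneg_right hK h2)
      _ = Real.exp B * (1 + Real.exp E) * Real.exp (-(T / 2)) := by ring
      _ ≤ _ := by
          gcongr
          exact le_add_of_nonneg_right (by positivity)
  · refine ⟨d, le_rfl, fun j => Matrix.of fun i => (0 : Matrix (Fin s × Fin d) (Fin d) (ZMod b)) (j, i),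
      (worstCaseError_digitalNet_le_two_mul hu 0).trans (ENNReal.ofReal_le_ofReal ?_)⟩
    have hdR : (d : ℝ) ^ p ≤ R := by
      have h := Real.rpow_le_rpow (by positivity) (not_le.mp hd).le
        (by positivity : 0 ≤ p / (p - 1))
      rwa [← Real.rpow_mul (Nat.cast_nonneg d), mul_div_cancel₀ _ hp0.ne'] at h
    have h1 : 1 ≤ Real.exp (1 / (8 * L) * R) * Real.exp (-(1 / (8 * L)) * (d : ℝ) ^ p) := by
      rw [← Real.exp_add]
      refine Real.one_le_exp ?_
      have : 1 / (8 * L) * (d : ℝ) ^ p ≤ 1 / (8 * L) * R := by gcongr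
      linarith
    calc 2 * ∏ j : Fin s, (1 + u j) ≤ 2 * Real.exp B * 1 := by linarith
      _ ≤ 2 * Real.exp B * (Real.exp (1 / (8 * L) * R) * Real.exp (-(1 / (8 * L)) * (d : ℝ) ^ p)) := by
          gcongr
      _ = 2 * Real.exp B * Real.exp (1 / (8 * L) * R) * Real.exp (-(1 / (8 * L)) * (d : ℝ) ^ p) := by
          ring
      _ ≤ _ := by
          gcongr
          exact le_add_of_nonneg_left (by positivity)

/-- The same bound in terms of the number `n` of function values. -/
theorem exists_digitalNet_le_exp_log_rpow {b : ℕ} (hb : 2 ≤ b) {p : ℝ} (hp1 : 1 < p) {B : ℝ}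
    (hB : 0 < B) : ∃ C c : ℝ, 0 < C ∧ 0 < c ∧
    ∀ (u : ℕ → ℝ) (s : ℕ), (∀ j, 0 < u j) →
      (∀ lam : ℝ, 0 < lam → lam ≤ 1 →
        ∑ j : Fin s, u j ^ lam ≤ B * lam ^ (1 - 1 / (p - 1))) →
      ∀ n : ℕ, 1 ≤ n → ∃ l : ℕ, Nat.log b n ≤ l ∧
        ∃ G : Fin s → Matrix (Fin l) (Fin (Nat.log b n)) (ZMod b),
        worstCaseError u (qmcRule (digitalNet G)) ≤
          ENNReal.ofReal (C * Real.exp (-c * Real.log n ^ p)) := by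
  obtain ⟨C, c, hC, hc, h⟩ := exists_digitalNet_le_exp_rpow hb hp1 hB
  have hlogb : 0 < Real.log b := Real.log_pos (by exact_mod_cast hb)
  set Q : ℝ := (2 * Real.log b) ^ p
  have hQ : 0 < Q := by positivity
  refine ⟨C * Real.exp c, c / Q, by positivity, by positivity, fun u s hu hH n hn => ?_⟩
  obtain ⟨l, hl, G, hG⟩ := h u s hu hH (Nat.log b n)
  refine ⟨l, hl, G, hG.trans (ENNReal.ofReal_le_ofReal ?_)⟩
  set d := Nat.log b n
  have hlog : Real.log n ≤ (d + 1) * Real.log b := by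
    have h1 : (n : ℝ) ≤ (b : ℝ) ^ (d + 1) := by
      exact_mod_cast (Nat.lt_pow_succ_log_self (by omega) n).le
    have h2 := Real.log_le_log (by exact_mod_cast hn) h1
    rw [Real.log_pow] at h2
    exact_mod_cast h2
  have hlog0 : 0 ≤ Real.log n := Real.log_natCast_nonneg n
  -- The `+ 1` covers `d = 0`, that is `n < b`; it is paid for by the factor `exp c` in the
  -- constant.
  have hmain : Real.log n ^ p ≤ Q * ((d : ℝ) ^ p + 1) := by
    have h1 : Real.log n ≤ 2 * Real.log b * max (d : ℝ) 1 := by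
      refine hlog.trans ?_
      have : (d : ℝ) + 1 ≤ 2 * max (d : ℝ) 1 := by
        linarith [le_max_left (d : ℝ) 1, le_max_right (d : ℝ) 1]
      nlinarith
    have h2 : (max (d : ℝ) 1) ^ p ≤ (d : ℝ) ^ p + 1 := by
      rcases le_total (d : ℝ) 1 with h | h
      · rw [max_eq_right h, Real.one_rpow]
        linarith [Real.rpow_nonneg (Nat.cast_nonneg (α := ℝ) d) p]
      · rw [max_eq_left h]; linarith
    calc Real.log n ^ p ≤ (2 * Real.log b * max (d : ℝ) 1) ^ p :=
          Real.rpow_le_rpow hlog0 h1 (by linarith)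
      _ = Q * (max (d : ℝ) 1) ^ p := Real.mul_rpow (by positivity) (by positivity)
      _ ≤ _ := by gcongr
  rw [mul_assoc, ← Real.exp_add]
  gcongr
  have : c / Q * Real.log n ^ p ≤ c * ((d : ℝ) ^ p + 1) := by
    rw [div_mul_eq_mul_div, div_le_iff₀ hQ]
    nlinarith
  linarith

/-- The minimal error is at most the error of any quasi-Monte Carlo rule with at most `n` nodes. -/
theorem minError_le_worstCaseError_qmcRule {u : ℕ → ℝ} {s n N : ℕ} (hN : N ≤ n)
    {t : Fin N → Fin s → ℝ} (ht : ∀ i, t i ∈ cube s) :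
    minError u n s ≤ worstCaseError u (qmcRule t) := by
  -- Surplus nodes are placed at the origin and ignored by `φ`.
  refine iInf₂_le (qmcRule t) ⟨fun i => if h : (i : ℕ) < N then t ⟨i, h⟩ else 0, fun i => ?_,
    fun v => (∑ i : Fin N, v (Fin.castLE hN i)) / N, fun f => ?_⟩
  · by_cases h : (i : ℕ) < N
    · simpa [h] using ht _
    · simp [h, cube]
  · simp [qmcRule]

theorem minError_le_exp_log_rpow {p : ℝ} (hp1 : 1 < p) {B : ℝ} (hB : 0 < B) :
    ∃ C c : ℝ, 0 < C ∧ 0 < c ∧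
    ∀ (u : ℕ → ℝ) (s : ℕ), (∀ j, 0 < u j) →
      (∀ lam : ℝ, 0 < lam → lam ≤ 1 →
        ∑ j : Fin s, u j ^ lam ≤ B * lam ^ (1 - 1 / (p - 1))) →
      ∀ n : ℕ, 1 ≤ n →
        minError u n s ≤ ENNReal.ofReal (C * Real.exp (-c * Real.log n ^ p)) := by
  obtain ⟨C, c, hC, hc, h⟩ := exists_digitalNet_le_exp_log_rpow le_rfl hp1 hB
  refine ⟨C, c, hC, hc, fun u s hu hH n hn => ?_⟩
  obtain ⟨l, -, G, hG⟩ := h u s hu hH n hn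
  refine (minError_le_worstCaseError_qmcRule (Nat.pow_log_le_self 2 (by omega)) fun k => ?_).trans hG
  exact digitPoint_mem_cube ((Matrix.of fun i : Fin s × Fin l => G i.1 i.2).mulVec (digitVec 2 _ k))

/-! ### Power sums of rapidly decaying weights. -/

/-- For `t ≥ 1`, one term of the exponential series, of order `m ≥ 2 / q`, already dominates `t ^
2`. -/
theorem exp_neg_mul_rpow_le {c q : ℝ} (hc : 0 < c) (hq : 0 < q) :
    ∃ M : ℝ, 0 < M ∧ ∀ t : ℝ, 0 ≤ t → Real.exp (-(c * t ^ q)) ≤ M / (1 + t) ^ 2 := by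
  obtain ⟨m, hm⟩ := exists_nat_ge (2 / q)
  rw [div_le_iff₀ hq] at hm
  refine ⟨4 + 4 * (m.factorial / c ^ m), by positivity, fun t ht => ?_⟩
  rw [le_div_iff₀ (by positivity)]
  have hf : 0 ≤ m.factorial / c ^ m := by positivity
  rcases le_total t 1 with h1 | h1
  · have h2 : Real.exp (-(c * t ^ q)) ≤ 1 := Real.exp_le_one_iff.mpr (by
      have := Real.rpow_nonneg ht q
      nlinarith)
    have h3 : (1 + t) ^ 2 ≤ 4 := by nlinarith
    nlinarith [Real.exp_pos (-(c * t ^ q)), sq_nonneg (1 + t)]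
  · have ht0 : 0 < t := by linarith
    have h2 := Real.pow_div_factorial_le_exp (c * t ^ q) (by positivity) m
    have h3 : t ^ 2 ≤ (t ^ q) ^ m := by
      rw [← Real.rpow_natCast (t ^ q), ← Real.rpow_mul ht, ← Real.rpow_natCast t 2]
      exact Real.rpow_le_rpow_of_exponent_le h1 (by push_cast; linarith)
    have h4 : c ^ m * t ^ 2 / m.factorial ≤ Real.exp (c * t ^ q) := by
      refine le_trans ?_ h2
      rw [mul_pow]
      gcongr
    have h5 : Real.exp (-(c * t ^ q)) * t ^ 2 ≤ m.factorial / c ^ m := by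
      rw [Real.exp_neg, inv_mul_le_iff₀ (Real.exp_pos _), mul_div_assoc', le_div_iff₀ (by positivity)]
      rw [div_le_iff₀ (by positivity)] at h4
      linarith
    have h6 : (1 + t) ^ 2 ≤ 4 * t ^ 2 := by nlinarith
    nlinarith [Real.exp_pos (-(c * t ^ q))]

/-- Telescoping comparison with `1 / ((1 + δ j) (1 + δ (j + 1)))`. -/
theorem sum_inv_one_add_mul_sq_le {δ : ℝ} (hδ : 0 < δ) (s : ℕ) :
    ∑ j ∈ Finset.range s, 1 / (1 + δ * (j + 1)) ^ 2 ≤ 1 / δ := by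
  have h : ∑ j ∈ Finset.range s, 1 / (1 + δ * ((j : ℝ) + 1)) ^ 2 ≤
      (1 - 1 / (1 + δ * s)) / δ := by
    induction s with
    | zero => simp
    | succ s ih =>
      rw [Finset.sum_range_succ]
      have h1 : 1 / (1 + δ * ((s : ℝ) + 1)) ^ 2 ≤
          (1 / (1 + δ * s) - 1 / (1 + δ * (s + 1))) / δ := by
        have ha : 0 < 1 + δ * (s : ℝ) := by positivity
        have hb : 0 < 1 + δ * ((s : ℝ) + 1) := by positivity
        have : (1 / (1 + δ * s) - 1 / (1 + δ * (s + 1))) / δ =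
            1 / ((1 + δ * s) * (1 + δ * (s + 1))) := by
          field_simp
          ring
        rw [this, sq]
        gcongr
        linarith
      calc _ ≤ (1 - 1 / (1 + δ * s)) / δ + (1 / (1 + δ * s) - 1 / (1 + δ * (s + 1))) / δ :=
            add_le_add ih h1
        _ = _ := by push_cast; ring
  refine h.trans ?_
  gcongr
  have : 0 ≤ 1 / (1 + δ * s) := by positivity
  linarith

/-- With `δ = lam ^ (1 / q)` the exponent `lam * c * (j + 1) ^ q` is `c * (δ * (j + 1)) ^ q`. The
sum is then a Riemann sum of mesh `δ`, of order `1 / δ`. -/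
theorem sum_rpow_le_of_le_exp {u : ℕ → ℝ} (hu : ∀ j, 0 < u j) {C c q : ℝ} (hC : 1 ≤ C) (hc : 0 < c)
    (hq : 0 < q) (h : ∀ j : ℕ, u j ≤ C * Real.exp (-(c * ((j : ℝ) + 1) ^ q))) :
    ∃ B : ℝ, 0 < B ∧ ∀ (s : ℕ) (lam : ℝ), 0 < lam → lam ≤ 1 →
      ∑ j : Fin s, u j ^ lam ≤ B * lam ^ (-(1 / q)) := by
  obtain ⟨M, hM, hexp⟩ := exp_neg_mul_rpow_le hc hq
  refine ⟨C * M, by positivity, fun s lam h0 h1 => ?_⟩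
  set δ : ℝ := lam ^ (1 / q)
  have hδ : 0 < δ := by positivity
  have hδq : δ ^ q = lam := by
    rw [← Real.rpow_mul h0.le, one_div_mul_cancel hq.ne', Real.rpow_one]
  have hterm : ∀ j : ℕ, u j ^ lam ≤ C * M * (1 / (1 + δ * ((j : ℝ) + 1)) ^ 2) := by
    intro j
    calc u j ^ lam ≤ (C * Real.exp (-(c * ((j : ℝ) + 1) ^ q))) ^ lam :=
          Real.rpow_le_rpow (hu j).le (h j) h0.le
      _ = C ^ lam * Real.exp (-(c * (δ * ((j : ℝ) + 1)) ^ q)) := by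
          rw [Real.mul_rpow (by positivity) (Real.exp_pos _).le, ← Real.exp_mul,
            Real.mul_rpow hδ.le (by positivity), hδq]
          congr 2
          ring
      _ ≤ C * (M / (1 + δ * ((j : ℝ) + 1)) ^ 2) := by
          gcongr
          · exact (Real.rpow_le_rpow_of_exponent_le hC h1).trans_eq (Real.rpow_one C)
          · exact hexp _ (by positivity)
      _ = _ := by ring
  rw [Fin.sum_univ_eq_sum_range fun j => u j ^ lam]
  calc ∑ j ∈ Finset.range s, u j ^ lam
      ≤ ∑ j ∈ Finset.range s, C * M * (1 / (1 + δ * ((j : ℝ) + 1)) ^ 2) :=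
        Finset.sum_le_sum fun j _ => hterm j
    _ ≤ C * M * (1 / δ) := by
        rw [← Finset.mul_sum]
        gcongr
        exact sum_inv_one_add_mul_sq_le hδ s
    _ = _ := by rw [Real.rpow_neg h0.le, one_div]

/-- Any real `c` strictly between 0 and the liminf works eventually; `C` absorbs the finitely many
earlier weights. -/
theorem le_exp_of_liminf_pos {u : ℕ → ℝ} (hu : ∀ j, 0 < u j) {q : ℝ}
    (h : 0 < Filter.liminf
      (fun j : ℕ => ((Real.log (u j)⁻¹ / ((j : ℝ) + 1) ^ q : ℝ) : EReal)) Filter.atTop) :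
    ∃ C c : ℝ, 1 ≤ C ∧ 0 < c ∧ ∀ j : ℕ, u j ≤ C * Real.exp (-(c * ((j : ℝ) + 1) ^ q)) := by
  obtain ⟨c, hc0, hc⟩ := EReal.lt_iff_exists_real_btwn.mp h
  have hc0' : 0 < c := by exact_mod_cast hc0
  obtain ⟨J, hJ⟩ := Filter.eventually_atTop.mp (Filter.eventually_lt_of_lt_liminf hc)
  have hnn : ∀ j, 0 ≤ u j * Real.exp (c * ((j : ℝ) + 1) ^ q) := fun j =>
    mul_nonneg (hu j).le (Real.exp_pos _).le
  refine ⟨1 + ∑ j ∈ Finset.range J, u j * Real.exp (c * ((j : ℝ) + 1) ^ q), c,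
    le_add_of_nonneg_right (Finset.sum_nonneg fun j _ => hnn j), hc0', fun j => ?_⟩
  rw [Real.exp_neg, ← div_eq_mul_inv, le_div_iff₀ (Real.exp_pos _)]
  rcases lt_or_ge j J with hj | hj
  · have := Finset.single_le_sum (fun j _ => hnn j) (Finset.mem_range.mpr hj)
    linarith
  · have h1 : c < Real.log (u j)⁻¹ / ((j : ℝ) + 1) ^ q := by exact_mod_cast hJ j hj
    rw [lt_div_iff₀ (by positivity), Real.log_inv] at h1
    have h2 : u j * Real.exp (c * ((j : ℝ) + 1) ^ q) ≤ 1 := by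
      calc _ = Real.exp (Real.log (u j) + c * ((j : ℝ) + 1) ^ q) := by
            rw [Real.exp_add, Real.exp_log (hu j)]
        _ ≤ 1 := Real.exp_le_one_iff.mpr (by linarith)
    exact h2.trans (le_add_of_nonneg_right (Finset.sum_nonneg fun j _ => hnn j))

end SmoothIntegration

end

theorem theorem4p2 (u : ℕ → ℝ) (hpos : ∀ j, 0 < u j) (hanti : Antitone u) :
    -- convergence for each fixed dimension
    ((∀ s : ℕ, 1 ≤ s → ∃ c₅ c₆ : ℝ, 0 < c₅ ∧ 0 < c₆ ∧ ∀ n : ℕ, 1 ≤ n →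
        SmoothIntegration.minError u n s ≤
          ENNReal.ofReal (c₅ * Real.exp (-c₆ * Real.log n ^ 2))) ∧
      -- attained, in every base, by digital nets with `b ^ ⌊log_b n⌋ ≤ n` points
      (∀ b : ℕ, 2 ≤ b → ∀ s : ℕ, 1 ≤ s → ∃ c₅ c₆ : ℝ, 0 < c₅ ∧ 0 < c₆ ∧ ∀ n : ℕ, 1 ≤ n →
        ∃ l : ℕ, Nat.log b n ≤ l ∧
          ∃ G : Fin s → Matrix (Fin l) (Fin (Nat.log b n)) (ZMod b),
            SmoothIntegration.worstCaseError u
                (SmoothIntegration.qmcRule (SmoothIntegration.digitalNet G)) ≤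
              ENNReal.ofReal (c₅ * Real.exp (-c₆ * Real.log n ^ 2)))) ∧
    -- dimension-independent convergence for rapidly decaying weights
    (∀ p : ℝ, 1 < p → p < 2 →
      0 < Filter.liminf
        (fun j : ℕ => ((Real.log (u j)⁻¹ / ((j : ℝ) + 1) ^ ((p - 1) / (2 - p)) : ℝ) : EReal))
        Filter.atTop →
      (∃ C c : ℝ, 0 < C ∧ 0 < c ∧ ∀ s n : ℕ, 1 ≤ s → 1 ≤ n →
        SmoothIntegration.minError u n s ≤
          ENNReal.ofReal (C * Real.exp (-c * Real.log n ^ p))) ∧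
      (∀ b : ℕ, 2 ≤ b → ∃ C c : ℝ, 0 < C ∧ 0 < c ∧ ∀ s n : ℕ, 1 ≤ s → 1 ≤ n →
        ∃ l : ℕ, Nat.log b n ≤ l ∧
          ∃ G : Fin s → Matrix (Fin l) (Fin (Nat.log b n)) (ZMod b),
            SmoothIntegration.worstCaseError u
                (SmoothIntegration.qmcRule (SmoothIntegration.digitalNet G)) ≤
              ENNReal.ofReal (C * Real.exp (-c * Real.log n ^ p)))) := by
  -- At `p = 2` the exponent of `lam` is zero, so boundedness suffices: `u ^ lam ≤ 1 + u`.
  have hfixed : ∀ s : ℕ, ∃ B : ℝ, 0 < B ∧ ∀ lam : ℝ, 0 < lam → lam ≤ 1 →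
      ∑ j : Fin s, u j ^ lam ≤ B * lam ^ (1 - 1 / ((2 : ℝ) - 1)) := by
    intro s
    refine ⟨1 + ∑ j : Fin s, (1 + u j), ?_, fun lam h0 h1 => ?_⟩
    · have := Finset.sum_nonneg fun (j : Fin s) (_ : j ∈ Finset.univ) => (by linarith [hpos j] :
        (0 : ℝ) ≤ 1 + u j)
      linarith
    · rw [show (1 : ℝ) - 1 / (2 - 1) = 0 by norm_num, Real.rpow_zero, mul_one]
      have : ∑ j : Fin s, u j ^ lam ≤ ∑ j : Fin s, (1 + u j) := Finset.sum_le_sum fun j _ =>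
        calc u j ^ lam ≤ (1 + u j) ^ lam :=
              Real.rpow_le_rpow (hpos j).le (by linarith) h0.le
          _ ≤ (1 + u j) ^ (1 : ℝ) :=
              Real.rpow_le_rpow_of_exponent_le (by linarith [hpos j]) h1
          _ = _ := Real.rpow_one _
      linarith
  refine ⟨⟨fun s _ => ?_, fun b hb s _ => ?_⟩, fun p hp1 hp2 hlim => ?_⟩
  · obtain ⟨B, hB, hH⟩ := hfixed s
    obtain ⟨C, c, hC, hc, h⟩ := SmoothIntegration.minError_le_exp_log_rpow one_lt_two hB
    exact ⟨C, c, hC, hc, fun n hn => by simpa using h u s hpos hH n hn⟩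
  · obtain ⟨B, hB, hH⟩ := hfixed s
    obtain ⟨C, c, hC, hc, h⟩ := SmoothIntegration.exists_digitalNet_le_exp_log_rpow hb one_lt_two hB
    exact ⟨C, c, hC, hc, fun n hn => by simpa using h u s hpos hH n hn⟩
  · obtain ⟨C₀, c₀, hC₀, hc₀, hu⟩ := SmoothIntegration.le_exp_of_liminf_pos hpos hlim
    have hp1' : 0 < p - 1 := by linarith
    have hp2' : 0 < 2 - p := by linarith
    obtain ⟨B, hB, hH⟩ := SmoothIntegration.sum_rpow_le_of_le_exp hpos hC₀ hc₀
      (div_pos hp1' hp2') hu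
    -- This identity is where the decay exponent `(p - 1) / (2 - p)` comes from.
    have hexp : -(1 / ((p - 1) / (2 - p))) = 1 - 1 / (p - 1) := by
      field_simp
      ring
    rw [hexp] at hH
    constructor
    · obtain ⟨C, c, hC, hc, h⟩ := SmoothIntegration.minError_le_exp_log_rpow hp1 hB
      exact ⟨C, c, hC, hc, fun s n _ hn => h u s hpos (hH s) n hn⟩
    · intro b hb
      obtain ⟨C, c, hC, hc, h⟩ := SmoothIntegration.exists_digitalNet_le_exp_log_rpow hb hp1 hB
      exact ⟨C, c, hC, hc, fun s n _ hn => h u s hpos (hH s) n hn⟩
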